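/- For $\theta\in[0,\pi]$ put $v_1=\cos(\tfrac{\pi}{2}-\theta)$, $v_2=\cos(-\tfrac{\pi}{6}-\theta)$, $v_3=\cos(\tfrac{7\pi}{6}-\theta)$ and $$\varphi_\theta(x)=\tfrac13\sum_{j=1}^3e^{-ixv_j},\qquad \widetilde\nu_k=\tfrac13\sum_{j=1}^3\delta_{3^{-k}v_j},\qquad \nu_n=\widetilde\nu_1*\cdots*\widetilde\nu_n,\qquad f_{n,\theta}=\tfrac12\,\nu_n*3^n\chi_{[-3^{-n},3^{-n}]}$$ (with $\nu_0=\delta_0$). For $\epsilon_0>0$ and $N\in\mathbb N$ put $K=N^{\epsilon_0}$, $m=2\epsilon_0\log_3N$ and $$E=E_N=\Bigl\{\theta\in[0,\pi]:\ \bigl|\{x:\max_{n\le N}f_{n,\theta}(x)\ge K\}\bigr|\le K^{-3}\Bigr\},$$ and for $n\in\mathbb N$ put $I=[3^{n-m},3^n]$. Here $|\cdot|$ is Lebesgue measure. **Theorem.** There are absolute constants $A_0\ge1$ and $c,C>0$ such that for every $A\ge A_0$ and $\epsilon_0>0$ there is $N_0$ such that the following holds for all $N\ge N_0$ with $|E_N|\ge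 N^{-\epsilon_0}$. (i) There are an integer $n$ with $N/4<n<N/2$ and a measurable set $\tilde E\subset E_N$ with $|\tilde E|>|E_N|/2$ such that for all $\theta\in\tilde E$ $$\int_I\prod_{k=0}^n|\varphi_\theta(3^{-k}x)|^2\,dx\le \frac{CKm}{N}\qquad\text{and}\qquad \int_I\prod_{k=0}^n|\varphi_\theta(3^{-k}x)|^2\,dx\ \ge\ c\,3^{m-2Am}=c\,N^{-2\epsilon_0(2A-1)}.$$ (ii) For every integer $n$ with $N/4<n<N/2$ and every measurable $\tilde E\subset E_N$ with $|\tilde E|>|E_N|/2$ there is a measurable $\mathcal E\subset\tilde E$ with $|\mathcal E|>|\tilde E|/2$ such that for all $\theta\in\mathcal E$ $$\int_I\prod_{k=0}^n|\varphi_\theta(3^{-k}x)|^2\,dx\ \ge\ c\,3^{m-2Am}.$$ The identity $3^{m-2Am}=N^{-2\epsilon_0(2A-1)}$ holds for all $N\ge N_0$, whether or not $|E_N|\ge N^{-\epsilon_0}$. -/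

import Mathlib

open MeasureTheory Set

noncomputable section

namespace Gasket

/-- The three projected vertices `cos (π/2 - θ)`, `cos (-π/6 - θ)`, `cos (7π/6 - θ)`. -/
def vertex (θ : ℝ) : Fin 3 → ℝ :=
  ![Real.cos (Real.pi / 2 - θ), Real.cos (-Real.pi / 6 - θ), Real.cos (7 * Real.pi / 6 - θ)]

/-- The measure `ν̃_k = (1/3) ∑_j δ_{3^{-k} cos (·)}`. -/
def nuTilde (k : ℕ) (θ : ℝ) : Measure ℝ :=
  (3 : ENNReal)⁻¹ • ∑ j : Fin 3, Measure.dirac (((3 : ℝ) ^ k)⁻¹ * vertex θ j)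

/-- The convolution `ν_n = ν̃_1 * ⋯ * ν̃_n`. -/
def nu : ℕ → ℝ → Measure ℝ
  | 0, _ => Measure.dirac 0
  | n + 1, θ => Measure.conv (nu n θ) (nuTilde (n + 1) θ)

/-- The projection multiplicity function `f_{n,θ} = (1/2) ν_n * (3^n χ_{[-3^{-n}, 3^{-n}]})`. -/
def f (n : ℕ) (θ x : ℝ) : ℝ :=
  (1 / 2) * ∫ y, (3 : ℝ) ^ n *
    (Icc (-((3 : ℝ) ^ n)⁻¹) (((3 : ℝ) ^ n)⁻¹)).indicator (fun _ => (1 : ℝ)) (x - y) ∂(nu n θ)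

/-- The maximal function `f*_{N,θ} = max_{n ≤ N} f_{n,θ}`. -/
def fMax (N : ℕ) (θ x : ℝ) : ℝ :=
  (Finset.range (N + 1)).sup' Finset.nonempty_range_add_one (fun n => f n θ x)

/-- The set `A*_{K,N,θ} = {x : f*_{N,θ}(x) ≥ K}`. -/
def AMax (K : ℝ) (N : ℕ) (θ : ℝ) : Set ℝ := {x | K ≤ fMax N θ x}

/-- `K = N^{ε₀}`. -/
def K (ε₀ : ℝ) (N : ℕ) : ℝ := (N : ℝ) ^ ε₀

/-- `m = 2 ε₀ log₃ N` (a real number). -/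
def m (ε₀ : ℝ) (N : ℕ) : ℝ := 2 * ε₀ * Real.logb 3 N

/-- The set of directions `E_N = {θ : |A*_{K,N,θ}| ≤ K^{-3}}`, with `K = N^{ε₀}`. -/
def E (ε₀ : ℝ) (N : ℕ) : Set ℝ :=
  {θ | θ ∈ Icc 0 Real.pi ∧
    volume (AMax (K ε₀ N) N θ) ≤ ENNReal.ofReal (K ε₀ N ^ (-3 : ℝ))}

/-- `φ_θ(x) = (1/3) ∑_j exp (-i x cos (·))`. -/
def phi (θ x : ℝ) : ℂ :=
  (1 / 3) * ∑ j : Fin 3, Complex.exp (-Complex.I * (x * vertex θ j : ℝ))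

/-- The integral over `I = [3^{n-m}, 3^n]` of `∏_{k=0}^n |φ_θ(3^{-k} x)|²`. -/
def sampleIntegral (ε₀ : ℝ) (N n : ℕ) (θ : ℝ) : ℝ :=
  ∫ x in Icc ((3 : ℝ) ^ ((n : ℝ) - m ε₀ N)) ((3 : ℝ) ^ (n : ℝ)),
    ∏ k ∈ Finset.range (n + 1), ‖phi θ (((3 : ℝ) ^ k)⁻¹ * x)‖ ^ 2

end Gasket

end

/-! Up to scaling, `∏ φ_θ(3^{-k} x)` over `k < l` is the Fourier transform of `ν_l`. Write `P_l` for
its squared modulus and `κ = K`. Three ingredients give the theorem.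

Energy. For `θ ∈ E`, `f_{n,θ}` has `L²` norm squared `O(κ)` for every `n ≤ N`
(`lintegral_cnt_sq_le`). A stopping time at the first scale where about `κ` atoms pile up,
self-similarity below that scale and the bound `κ^{-3}` on the exceptional set make the induction
close. With a Fejér weight the energy becomes `∫_0^t P_l ≤ 240 κ` for `t ≤ 3^l / 6`
(`integral_partialProd_le`). The diagonal terms alone give `∫_0^T P_l ≥ 3^{-l} T / 2`
(`le_integral_partialProd`).

Lower bound. Take `3^l` comparable to `3^{n-m}`. On `[0, 3^n]` the integral of `P_l` is at least of
order `3^m = κ²`, and only `O(κ)` of it lies left of `I`, so `∫_I P_l` is of order `κ²`. The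
remaining factors, of index `l` to `n`, are bounded below pointwise. If `φ_θ(y)` is small then
`φ_θ(3y)` is close to `1`, and the factors after it recover at a geometric rate, so one small factor
`δ` costs only `δ² 81^{-L}` over `L` factors (`prod_mul_max_ge`). A factor below `δ` forces `θ` to
be nearly parallel to one of `O(κ⁴)` lattice vectors. With `δ = κ^{-8}` these directions have
measure below `N^{-ε₀} / 8 ≤ |E| / 8`, and the loss `κ^{-24}` accounts for `A ≥ 6`.

Upper bound. On `[0, 3^n]` the product is at most `2 P_N`, and a point lies in at most `m + 1` of
the intervals `I`. Hence the sum over `n` is `O(κ m)`, and averaging over the roughly `N / 4`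
admissible `n` and over `θ ∈ E` finds an `n` that is good for most `θ`. -/

namespace Gasket

/-! ### Atoms of `ν_n`, the counting form of `f_{n,θ}`, and measurability -/

/-- The atom of `ν_n` attached to the word `w`. -/
noncomputable def pt (n : ℕ) (θ : ℝ) (w : Fin n → Fin 3) : ℝ :=
  ∑ i : Fin n, ((3 : ℝ) ^ (i.val + 1))⁻¹ * vertex θ (w i)

/-- The number of atoms of `ν_n`, with multiplicity, in the closed `r`-ball about `x`. -/
noncomputable def cnt (r : ℝ) (n : ℕ) (θ x : ℝ) : ℕ :=
  (Finset.univ.filter fun w : Fin n → Fin 3 => |x - pt n θ w| ≤ r).card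

lemma cnt_eq_sum (r : ℝ) (n : ℕ) (θ x : ℝ) :
    cnt r n θ x = ∑ w : Fin n → Fin 3, if |x - pt n θ w| ≤ r then 1 else 0 := by
  rw [cnt, Finset.card_filter]

lemma abs_vertex_le (θ : ℝ) (j : Fin 3) : |vertex θ j| ≤ 1 := by
  fin_cases j <;> exact Real.abs_cos_le_one _

lemma continuous_vertex (j : Fin 3) : Continuous fun θ => vertex θ j := by
  fin_cases j <;> simp [vertex] <;> fun_prop

lemma continuous_pt (n : ℕ) (w : Fin n → Fin 3) : Continuous fun θ => pt n θ w := by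
  unfold pt
  exact continuous_finsetSum _ fun i _ => continuous_const.mul (continuous_vertex _)

lemma pt_zero (θ : ℝ) (w : Fin 0 → Fin 3) : pt 0 θ w = 0 := by simp [pt]

lemma pt_snoc (n : ℕ) (θ : ℝ) (w : Fin n → Fin 3) (j : Fin 3) :
    pt (n + 1) θ (Fin.snoc w j) = pt n θ w + ((3 : ℝ) ^ (n + 1))⁻¹ * vertex θ j := by
  simp [pt, Fin.sum_univ_castSucc]

lemma pt_append (k r : ℕ) (θ : ℝ) (u : Fin k → Fin 3) (w : Fin r → Fin 3) :
    pt (k + r) θ (Fin.append u w) = pt k θ u + ((3 : ℝ) ^ k)⁻¹ * pt r θ w := by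
  simp only [pt, Fin.sum_univ_add, Fin.append_left, Fin.append_right, Fin.val_castAdd,
    Fin.val_natAdd, Finset.mul_sum]
  congr 1
  refine Finset.sum_congr rfl fun i _ => ?_
  rw [add_assoc, pow_add]
  field_simp

lemma abs_pt_le (n : ℕ) (θ : ℝ) (w : Fin n → Fin 3) :
    |pt n θ w| ≤ (1 - ((3 : ℝ) ^ n)⁻¹) / 2 := by
  induction n with
  | zero => simp [pt_zero]
  | succ n ih =>
    obtain ⟨u, j, rfl⟩ : ∃ u j, w = Fin.snoc (α := fun _ => Fin 3) u j :=
      ⟨Fin.init w, w (Fin.last n), (Fin.snoc_init_self w).symm⟩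
    rw [pt_snoc]
    have h1 := ih u
    have h2 : |((3 : ℝ) ^ (n + 1))⁻¹ * vertex θ j| ≤ ((3 : ℝ) ^ (n + 1))⁻¹ := by
      rw [abs_mul, abs_of_pos (by positivity)]
      exact mul_le_of_le_one_right (by positivity) (abs_vertex_le θ j)
    have h3 : ((3 : ℝ) ^ n)⁻¹ = 3 * ((3 : ℝ) ^ (n + 1))⁻¹ := by rw [pow_succ]; field_simp
    have := abs_add_le (pt n θ u) (((3 : ℝ) ^ (n + 1))⁻¹ * vertex θ j)
    linarith

lemma sum_words_succ {M : Type*} [AddCommMonoid M] (n : ℕ) (g : (Fin (n + 1) → Fin 3) → M) :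
    ∑ w, g w = ∑ u : Fin n → Fin 3, ∑ j : Fin 3, g (Fin.snoc u j) := by
  rw [← (Fin.snocEquiv fun _ => Fin 3).sum_comp, Fintype.sum_prod_type, Finset.sum_comm]
  rfl

lemma sum_words_add {M : Type*} [AddCommMonoid M] (k r : ℕ) (g : (Fin (k + r) → Fin 3) → M) :
    ∑ w, g w = ∑ u : Fin k → Fin 3, ∑ w : Fin r → Fin 3, g (Fin.append u w) := by
  rw [← (Fin.appendEquiv k r).sum_comp, Fintype.sum_prod_type]
  rfl

instance (n : ℕ) (θ : ℝ) : IsFiniteMeasure (nuTilde n θ) := by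
  unfold nuTilde
  rw [Fin.sum_univ_three]
  exact Measure.smul_finite _ (by simp)

lemma lintegral_nu (n : ℕ) (θ : ℝ) {g : ℝ → ENNReal} (hg : Measurable g) :
    ∫⁻ x, g x ∂(nu n θ) = ((3 : ENNReal)⁻¹) ^ n * ∑ w : Fin n → Fin 3, g (pt n θ w) := by
  induction n generalizing g with
  | zero => simp [nu, pt_zero, lintegral_dirac' _ hg]
  | succ n ih =>
    rw [nu, Measure.lintegral_conv hg]
    have : ∀ x, ∫⁻ y, g (x + y) ∂(nuTilde (n + 1) θ)
        = (3 : ENNReal)⁻¹ * ∑ j : Fin 3, g (x + ((3 : ℝ) ^ (n + 1))⁻¹ * vertex θ j) := by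
      intro x
      have hg' : Measurable fun y => g (x + y) := by fun_prop
      rw [nuTilde, lintegral_smul_measure, lintegral_finsetSum_measure, smul_eq_mul]
      simp_rw [lintegral_dirac' _ hg']
    simp_rw [this]
    rw [ih (by fun_prop), sum_words_succ, pow_succ (3⁻¹ : ENNReal) n, mul_assoc, ← Finset.mul_sum]
    simp_rw [pt_snoc]

lemma nu_eq (n : ℕ) (θ : ℝ) :
    nu n θ = ((3 : ENNReal)⁻¹) ^ n • ∑ w : Fin n → Fin 3, Measure.dirac (pt n θ w) := by
  refine Measure.ext_of_lintegral _ fun g hg => ?_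
  rw [lintegral_nu n θ hg, lintegral_smul_measure, lintegral_finsetSum_measure, smul_eq_mul]
  simp_rw [lintegral_dirac' _ hg]

lemma f_eq (n : ℕ) (θ x : ℝ) : f n θ x = cnt ((3 : ℝ) ^ n)⁻¹ n θ x / 2 := by
  rw [f, nu_eq, integral_smul_measure, integral_finsetSum_measure]
  · simp only [integral_dirac]
    have : ∀ y : ℝ, (Icc (-((3 : ℝ) ^ n)⁻¹) (((3 : ℝ) ^ n)⁻¹)).indicator (fun _ => (1 : ℝ)) (x - y)
        = if |x - y| ≤ ((3 : ℝ) ^ n)⁻¹ then 1 else 0 := by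
      intro y
      simp only [indicator_apply, mem_Icc, abs_le]
    simp_rw [this]
    rw [← Finset.mul_sum, cnt_eq_sum]
    push_cast
    simp only [ENNReal.toReal_pow, ENNReal.toReal_inv, ENNReal.toReal_ofNat, smul_eq_mul, inv_pow]
    field_simp
  · intro w _
    exact integrable_dirac enorm_lt_top

lemma measurable_cnt (r : ℝ) (n : ℕ) :
    Measurable fun p : ℝ × ℝ => cnt r n p.1 p.2 := by
  simp_rw [cnt_eq_sum]
  refine Finset.measurable_fun_sum _ fun w _ => Measurable.ite ?_ measurable_const measurable_const
  refine measurableSet_le ?_ measurable_const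
  exact ((continuous_snd.sub ((continuous_pt n w).comp continuous_fst)).abs).measurable

lemma measurable_cnt_right (r : ℝ) (n : ℕ) (θ : ℝ) : Measurable fun x => cnt r n θ x :=
  (measurable_cnt r n).comp (measurable_const.prodMk measurable_id)

lemma le_fMax_iff (N : ℕ) (θ x κ : ℝ) : κ ≤ fMax N θ x ↔ ∃ n ≤ N, κ ≤ f n θ x := by
  simp only [fMax, Finset.le_sup'_iff, Finset.mem_range, Nat.lt_succ_iff]

lemma measurableSet_le_fMax (N : ℕ) (κ : ℝ) :
    MeasurableSet {p : ℝ × ℝ | κ ≤ fMax N p.1 p.2} := by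
  simp only [le_fMax_iff, f_eq, ← Finset.mem_range_succ_iff]
  have : {p : ℝ × ℝ | ∃ n ∈ Finset.range (N + 1), κ ≤ (cnt ((3 : ℝ) ^ n)⁻¹ n p.1 p.2 : ℝ) / 2}
      = ⋃ n ∈ Finset.range (N + 1), {p | κ ≤ (cnt ((3 : ℝ) ^ n)⁻¹ n p.1 p.2 : ℝ) / 2} := by
    ext p; simp
  rw [this]
  refine Finset.measurableSet_biUnion _ fun n _ => measurableSet_le measurable_const ?_
  exact (measurable_from_top.comp (measurable_cnt _ n)).div_const _

lemma measurableSet_E (ε₀ : ℝ) (N : ℕ) : MeasurableSet (E ε₀ N) := by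
  have h : Measurable fun θ => volume (AMax (K ε₀ N) N θ) :=
    measurable_measure_prodMk_left (measurableSet_le_fMax N _)
  exact measurableSet_Icc.inter
    (measurableSet_le (g := fun _ => ENNReal.ofReal (K ε₀ N ^ (-3 : ℝ))) h measurable_const)

/-! ### The product of the `φ_θ` as an exponential sum over words -/

/-- The product starts at scale `3^0` but the atoms at `3^{-1}`, hence the factor `3` in the phase.
-/
lemma phi_prod_eq (l : ℕ) (θ x : ℝ) :
    ∏ k ∈ Finset.range l, phi θ (((3 : ℝ) ^ k)⁻¹ * x)
      = (3 ^ l : ℂ)⁻¹ * ∑ w : Fin l → Fin 3, Complex.exp (-Complex.I * (3 * pt l θ w * x : ℝ)) := by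
  rw [Finset.prod_range]
  simp only [phi, Finset.prod_mul_distrib]
  rw [Finset.prod_univ_sum]
  congr 1
  · simp
  · simp only [Fintype.piFinset_univ, ← Complex.exp_sum, ← Finset.mul_sum]
    refine Finset.sum_congr rfl fun w _ => ?_
    congr 2
    rw [pt, ← Complex.ofReal_sum]
    congr 1
    rw [Finset.mul_sum, Finset.sum_mul]
    refine Finset.sum_congr rfl fun i _ => ?_
    rw [pow_succ]
    field_simp

lemma normSq_sum_exp {ι : Type*} [Fintype ι] (a : ι → ℝ) :
    ‖∑ w, Complex.exp (-Complex.I * (a w : ℝ))‖ ^ 2 = ∑ w, ∑ w', Real.cos (a w - a w') := by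
  have h : ∀ w, Complex.exp (-Complex.I * (a w : ℝ))
      = (Real.cos (a w) : ℂ) - (Real.sin (a w) : ℂ) * Complex.I := by
    intro w
    rw [show -Complex.I * (a w : ℝ) = ((-a w : ℝ) : ℂ) * Complex.I by push_cast; ring,
      Complex.exp_mul_I, ← Complex.ofReal_cos, ← Complex.ofReal_sin]
    simp [sub_eq_add_neg]
  simp_rw [h]
  rw [Finset.sum_sub_distrib, ← Finset.sum_mul, ← Complex.ofReal_sum, ← Complex.ofReal_sum,
    Complex.sq_norm, Complex.normSq_apply]
  simp only [Complex.sub_re, Complex.ofReal_re, Complex.mul_re, Complex.I_re, Complex.ofReal_im,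
    Complex.I_im, Complex.sub_im, Complex.mul_im]
  simp only [Real.cos_sub, Finset.sum_add_distrib, ← Finset.mul_sum, ← Finset.sum_mul]
  ring

lemma prod_sq_phi_eq (l : ℕ) (θ x : ℝ) :
    ∏ k ∈ Finset.range l, ‖phi θ (((3 : ℝ) ^ k)⁻¹ * x)‖ ^ 2
      = ((9 : ℝ) ^ l)⁻¹ * ∑ w : Fin l → Fin 3, ∑ w' : Fin l → Fin 3,
          Real.cos (3 * (pt l θ w - pt l θ w') * x) := by
  rw [Finset.prod_pow, ← norm_prod, phi_prod_eq, norm_mul, mul_pow, normSq_sum_exp]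
  congr 1
  · simp only [norm_inv, norm_pow, Complex.norm_ofNat]
    rw [inv_pow, ← pow_mul, mul_comm, pow_mul]
    norm_num
  · refine Finset.sum_congr rfl fun w _ => Finset.sum_congr rfl fun w' _ => ?_
    ring_nf

lemma norm_phi_le_one (θ x : ℝ) : ‖phi θ x‖ ≤ 1 := by
  rw [phi, norm_mul]
  have h : ‖∑ j : Fin 3, Complex.exp (-Complex.I * (x * vertex θ j : ℝ))‖ ≤ 3 := by
    refine (norm_sum_le _ _).trans ?_
    simp only [neg_mul, Complex.norm_exp]
    simp
  have h3 : ‖(1 / 3 : ℂ)‖ = 1 / 3 := by norm_num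
  rw [h3]
  linarith

lemma continuous_phi : Continuous fun p : ℝ × ℝ => phi p.1 p.2 := by
  unfold phi
  refine continuous_const.mul (continuous_finsetSum _ fun j _ => ?_)
  refine Complex.continuous_exp.comp (continuous_const.mul (Complex.continuous_ofReal.comp ?_))
  exact continuous_snd.mul ((continuous_vertex j).comp continuous_fst)

/-! ### Triadic cells, self-similarity and the `L²` bound -/

/-- The index of the triadic interval of length `3^{-(k+1)}` that contains `x`. -/
noncomputable def cell (k : ℕ) (x : ℝ) : ℤ := ⌊(3 : ℝ) ^ (k + 1) * x⌋

/-- The centre of the triadic interval of length `3^{-(k+1)}` that contains `x`. -/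
noncomputable def ctr (k : ℕ) (x : ℝ) : ℝ := (cell k x + 1 / 2) * ((3 : ℝ) ^ (k + 1))⁻¹

/-- The number of atoms of `ν_k` close to the triadic interval around `x`. -/
noncomputable def stack (k : ℕ) (θ x : ℝ) : ℕ := cnt (5 / 6 * ((3 : ℝ) ^ k)⁻¹) k θ (ctr k x)

lemma abs_sub_ctr_le (k : ℕ) (x : ℝ) : |x - ctr k x| ≤ 1 / 6 * ((3 : ℝ) ^ k)⁻¹ := by
  have h1 := Int.floor_le ((3 : ℝ) ^ (k + 1) * x)
  have h2 := Int.lt_floor_add_one ((3 : ℝ) ^ (k + 1) * x)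
  have h3 : x - ctr k x = ((3 : ℝ) ^ (k + 1) * x - (cell k x + 1 / 2)) * ((3 : ℝ) ^ (k + 1))⁻¹ := by
    rw [ctr]; field_simp
  have h4 : (1 : ℝ) / 6 * ((3 : ℝ) ^ k)⁻¹ = 1 / 2 * ((3 : ℝ) ^ (k + 1))⁻¹ := by
    rw [pow_succ]; field_simp; norm_num
  rw [h3, h4, abs_mul, abs_of_pos (a := ((3 : ℝ) ^ (k + 1))⁻¹) (by positivity)]
  refine mul_le_mul_of_nonneg_right ?_ (by positivity)
  rw [abs_le, cell]
  constructor <;> linarith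

lemma cell_eq_cell_succ_div (k : ℕ) (x : ℝ) : cell k x = cell (k + 1) x / 3 := by
  have := Int.floor_div_natCast ((3 : ℝ) ^ (k + 1 + 1) * x) 3
  rw [cell, cell]
  push_cast at this
  rw [← this]
  congr 1
  rw [pow_succ (3 : ℝ) (k + 1)]
  ring

lemma cell_eq_of_le {i k : ℕ} (hik : i ≤ k) {x y : ℝ} (h : cell k x = cell k y) :
    cell i x = cell i y := by
  induction k, hik using Nat.le_induction with
  | base => exact h
  | succ k _ ih => exact ih (by rw [cell_eq_cell_succ_div, h, ← cell_eq_cell_succ_div])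

lemma stack_eq_of_le {i k : ℕ} (hik : i ≤ k) (θ : ℝ) {x y : ℝ} (h : cell k x = cell k y) :
    stack i θ x = stack i θ y := by
  rw [stack, stack, ctr, ctr, cell_eq_of_le hik h]

lemma abs_ctr_succ_sub_le (k : ℕ) (x : ℝ) :
    |ctr (k + 1) x - ctr k x| ≤ 1 / 9 * ((3 : ℝ) ^ k)⁻¹ := by
  have h1 : (cell (k + 1) x : ℝ) = 3 * (cell k x : ℝ) + ((cell (k + 1) x % 3 : ℤ) : ℝ) := by
    rw [cell_eq_cell_succ_div k x]
    exact_mod_cast (Int.mul_ediv_add_emod (cell (k + 1) x) 3).symm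
  have h2 : (0 : ℝ) ≤ ((cell (k + 1) x % 3 : ℤ) : ℝ) := by
    exact_mod_cast Int.emod_nonneg _ (by norm_num)
  have h3 : ((cell (k + 1) x % 3 : ℤ) : ℝ) ≤ 2 := by
    have : cell (k + 1) x % 3 ≤ 2 := by omega
    exact_mod_cast this
  have h4 : ctr (k + 1) x - ctr k x
      = (((cell (k + 1) x % 3 : ℤ) : ℝ) - 1) * (1 / 9 * ((3 : ℝ) ^ k)⁻¹) := by
    rw [ctr, ctr, h1, pow_succ, pow_succ]
    field_simp
    ring
  rw [h4, abs_mul, abs_of_pos (a := 1 / 9 * ((3 : ℝ) ^ k)⁻¹) (by positivity)]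
  refine mul_le_of_le_one_left (by positivity) ?_
  rw [abs_le]
  constructor <;> linarith

lemma cnt_mono {r r' : ℝ} (n : ℕ) (θ : ℝ) {x x' : ℝ} (h : r + |x - x'| ≤ r') :
    cnt r n θ x ≤ cnt r' n θ x' := by
  refine Finset.card_le_card fun w => ?_
  simp only [Finset.mem_filter, Finset.mem_univ, true_and]
  intro hw
  have := abs_sub_le x' x (pt n θ w)
  rw [abs_sub_comm x' x] at this
  linarith

lemma cnt_succ_le {r r' : ℝ} (n : ℕ) (θ : ℝ) {x x' : ℝ}
    (h : r + ((3 : ℝ) ^ (n + 1))⁻¹ + |x - x'| ≤ r') :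
    cnt r (n + 1) θ x ≤ 3 * cnt r' n θ x' := by
  rw [cnt_eq_sum, cnt_eq_sum, sum_words_succ, Finset.mul_sum]
  refine Finset.sum_le_sum fun u _ => ?_
  by_cases hu : |x' - pt n θ u| ≤ r'
  · rw [if_pos hu, Fin.sum_univ_three]
    split_ifs <;> norm_num
  · rw [if_neg hu]
    refine (Finset.sum_eq_zero fun j _ => if_neg fun hj => hu ?_).le
    rw [pt_snoc] at hj
    have h2 : |((3 : ℝ) ^ (n + 1))⁻¹ * vertex θ j| ≤ ((3 : ℝ) ^ (n + 1))⁻¹ := by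
      rw [abs_mul, abs_of_pos (by positivity)]
      exact mul_le_of_le_one_right (by positivity) (abs_vertex_le θ j)
    rw [abs_le] at hj h2 ⊢
    have h3 := abs_le.1 (le_refl |x - x'|)
    constructor <;> linarith

lemma stack_succ_le (k : ℕ) (θ x : ℝ) : stack (k + 1) θ x ≤ 3 * stack k θ x := by
  refine cnt_succ_le k θ ?_
  have := abs_ctr_succ_sub_le k x
  have h : ((3 : ℝ) ^ (k + 1))⁻¹ = 1 / 3 * ((3 : ℝ) ^ k)⁻¹ := by rw [pow_succ]; field_simp
  rw [h]
  have : (0 : ℝ) < ((3 : ℝ) ^ k)⁻¹ := by positivity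
  linarith

/-- In units of `3^{-k}` the radius `5/6` plus the half-length `1/6` of a cell is `1`, so a high
stack makes `f_{k,θ}` large on the whole cell. -/
lemma stack_le_cnt (k : ℕ) (θ x : ℝ) : stack k θ x ≤ cnt ((3 : ℝ) ^ k)⁻¹ k θ x := by
  refine cnt_mono k θ ?_
  have := abs_sub_ctr_le k x
  rw [abs_sub_comm]
  linarith

/-- In units of `3^{-k}`: radius `1/3`, displacement of the atom `1/3`, distance to the centre
`1/6`. Their sum is exactly the radius `5/6` of `stack`. -/
lemma cnt_succ_le_stack (k : ℕ) (θ x : ℝ) :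
    cnt ((3 : ℝ) ^ (k + 1))⁻¹ (k + 1) θ x ≤ 3 * stack k θ x := by
  refine cnt_succ_le k θ ?_
  have := abs_sub_ctr_le k x
  have h : ((3 : ℝ) ^ (k + 1))⁻¹ = 1 / 3 * ((3 : ℝ) ^ k)⁻¹ := by rw [pow_succ]; field_simp
  rw [h]
  linarith

lemma cnt_zero_le (r θ x : ℝ) : cnt r 0 θ x ≤ 1 := by
  refine (Finset.card_le_univ _).trans ?_
  simp

lemma cnt_add (k r : ℕ) (θ x : ℝ) :
    cnt ((3 : ℝ) ^ (k + r))⁻¹ (k + r) θ x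
      = ∑ u : Fin k → Fin 3, cnt ((3 : ℝ) ^ r)⁻¹ r θ ((3 : ℝ) ^ k * (x - pt k θ u)) := by
  simp_rw [cnt_eq_sum]
  rw [sum_words_add]
  refine Finset.sum_congr rfl fun u _ => Finset.sum_congr rfl fun w _ => ?_
  have h : (3 : ℝ) ^ k * (x - pt k θ u) - pt r θ w
      = (3 : ℝ) ^ k * (x - pt (k + r) θ (Fin.append u w)) := by
    rw [pt_append]
    field_simp
    ring
  have h' : |(3 : ℝ) ^ k * (x - pt k θ u) - pt r θ w| ≤ ((3 : ℝ) ^ r)⁻¹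
      ↔ |x - pt (k + r) θ (Fin.append u w)| ≤ ((3 : ℝ) ^ (k + r))⁻¹ := by
    rw [h, abs_mul, abs_of_pos (a := (3 : ℝ) ^ k) (by positivity), pow_add, mul_inv, mul_comm,
      ← le_div_iff₀ (by positivity), div_eq_mul_inv, mul_comm (((3 : ℝ) ^ r)⁻¹)]
  simp only [h']

/-- The support has radius `(1 + 3^{-r}) / 2`, which is at most `2/3` once `r ≥ 1`. -/
lemma cnt_eq_zero {r : ℕ} (hr : 1 ≤ r) (θ : ℝ) {y : ℝ} (hy : 2 / 3 < |y|) :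
    cnt ((3 : ℝ) ^ r)⁻¹ r θ y = 0 := by
  rw [cnt, Finset.card_eq_zero, Finset.filter_eq_empty_iff]
  intro w _ hw
  have h1 := abs_pt_le r θ w
  have h2 : ((3 : ℝ) ^ r)⁻¹ ≤ 1 / 3 := by
    rw [inv_le_comm₀ (by positivity) (by norm_num)]
    calc (1 / 3 : ℝ)⁻¹ = 3 ^ 1 := by norm_num
      _ ≤ 3 ^ r := pow_le_pow_right₀ (by norm_num) hr
  have h3 := abs_sub_abs_le_abs_sub y (pt r θ w)
  linarith

/-- By `cnt_add` the count at level `k + r` is a sum of rescaled level-`r` counts, one per atom of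
`ν_k`. Only atoms within `2/3 + 1/6 = 5/6` of the centre contribute, so Cauchy–Schwarz costs a
factor `stack`. -/
lemma cnt_add_sq_le (k : ℕ) {r : ℕ} (hr : 1 ≤ r) (θ x : ℝ) :
    cnt ((3 : ℝ) ^ (k + r))⁻¹ (k + r) θ x ^ 2 ≤ stack k θ x *
      ∑ u ∈ Finset.univ.filter
          fun u : Fin k → Fin 3 => |ctr k x - pt k θ u| ≤ 5 / 6 * ((3 : ℝ) ^ k)⁻¹,
        cnt ((3 : ℝ) ^ r)⁻¹ r θ ((3 : ℝ) ^ k * (x - pt k θ u)) ^ 2 := by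
  rw [cnt_add, stack, cnt]
  refine le_trans (le_of_eq ?_) sq_sum_le_card_mul_sum_sq
  congr 1
  refine (Finset.sum_subset (Finset.filter_subset _ _) fun u _ hu => cnt_eq_zero hr θ ?_).symm
  simp only [Finset.mem_filter, Finset.mem_univ, true_and, not_le] at hu
  rw [abs_mul, abs_of_pos (by positivity), ← div_lt_iff₀' (by positivity), div_eq_mul_inv]
  have h1 := abs_sub_ctr_le k x
  have h2 := abs_sub_le (ctr k x) x (pt k θ u)
  rw [abs_sub_comm (ctr k x) x] at h2
  linarith

lemma lintegral_comp_mul_sub {a : ℝ} (ha : 0 < a) (p : ℝ) {g : ℝ → ENNReal} (hg : Measurable g) :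
    ∫⁻ x, g (a * (x - p)) = ENNReal.ofReal a⁻¹ * ∫⁻ x, g x := by
  rw [lintegral_sub_right_eq_self (fun x => g (a * x)) p]
  conv_rhs => rw [← Real.smul_map_volume_mul_left ha.ne']
  rw [lintegral_smul_measure, lintegral_map hg (by fun_prop), smul_eq_mul, ← mul_assoc,
    abs_of_pos ha, ← ENNReal.ofReal_mul (by positivity), inv_mul_cancel₀ ha.ne']
  simp

lemma volume_cell (k : ℕ) (j : ℤ) :
    volume {y : ℝ | cell k y = j} = ENNReal.ofReal ((3 : ℝ) ^ (k + 1))⁻¹ := by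
  have : {y : ℝ | cell k y = j}
      = Ico ((j : ℝ) * ((3 : ℝ) ^ (k + 1))⁻¹) ((j + 1) * ((3 : ℝ) ^ (k + 1))⁻¹) := by
    ext y
    simp only [mem_ofPred_eq, cell, Int.floor_eq_iff, mem_Ico, ← div_eq_mul_inv]
    rw [div_le_iff₀ (by positivity), lt_div_iff₀ (by positivity), mul_comm y]
  rw [this, Real.volume_Ico]
  congr 1
  ring

lemma measurableSet_cell (k : ℕ) (j : ℤ) : MeasurableSet {y : ℝ | cell k y = j} := by
  have : Measurable fun y : ℝ => cell k y := Int.measurable_floor.comp (by fun_prop)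
  exact this (measurableSet_singleton j)

lemma setLIntegral_cell_le (k : ℕ) {r : ℕ} (hr : 1 ≤ r) (θ x : ℝ) {a M : ENNReal}
    (ha : (stack k θ x : ENNReal) ≤ a)
    (hM : ∫⁻ y, (cnt ((3 : ℝ) ^ r)⁻¹ r θ y : ENNReal) ^ 2 ≤ M) :
    ∫⁻ y in {y | cell k y = cell k x}, (cnt ((3 : ℝ) ^ (k + r))⁻¹ (k + r) θ y : ENNReal) ^ 2
      ≤ 3 * a ^ 2 * M * volume {y | cell k y = cell k x} := by
  set S := Finset.univ.filter
          fun u : Fin k → Fin 3 => |ctr k x - pt k θ u| ≤ 5 / 6 * ((3 : ℝ) ^ k)⁻¹ with hS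
  have hcard : (S.card : ENNReal) = stack k θ x := rfl
  have hmeas : Measurable fun y => (cnt ((3 : ℝ) ^ r)⁻¹ r θ y : ENNReal) ^ 2 :=
    ((measurable_from_top (f := fun n : ℕ => (n : ENNReal))).comp
      (measurable_cnt_right _ r θ)).pow_const 2
  calc _ ≤ ∫⁻ y in {y | cell k y = cell k x}, (stack k θ x : ENNReal) *
        ∑ u ∈ S, (cnt ((3 : ℝ) ^ r)⁻¹ r θ ((3 : ℝ) ^ k * (y - pt k θ u)) : ENNReal) ^ 2 := by
        refine setLIntegral_mono' (measurableSet_cell k _) fun y hy => ?_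
        have hy' : cell k y = cell k x := hy
        have := cnt_add_sq_le k hr θ y
        rw [stack_eq_of_le le_rfl θ hy', show ctr k y = ctr k x by rw [ctr, ctr, hy'], ← hS] at this
        exact_mod_cast this
    _ ≤ ∫⁻ y, (stack k θ x : ENNReal) *
        ∑ u ∈ S, (cnt ((3 : ℝ) ^ r)⁻¹ r θ ((3 : ℝ) ^ k * (y - pt k θ u)) : ENNReal) ^ 2 :=
        setLIntegral_le_lintegral _ _
    _ = stack k θ x * ∑ u ∈ S, (ENNReal.ofReal ((3 : ℝ) ^ k)⁻¹ *
          ∫⁻ y, (cnt ((3 : ℝ) ^ r)⁻¹ r θ y : ENNReal) ^ 2) := by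
        rw [lintegral_const_mul' _ _ (by simp), lintegral_finsetSum]
        · congr 1
          refine Finset.sum_congr rfl fun u _ => ?_
          rw [← lintegral_comp_mul_sub (by positivity) (pt k θ u) hmeas]
        · intro u _
          exact hmeas.comp (by fun_prop)
    _ ≤ a * (a * (ENNReal.ofReal ((3 : ℝ) ^ k)⁻¹ * M)) := by
        rw [Finset.sum_const, nsmul_eq_mul, hcard]
        gcongr
    _ = _ := by
        rw [volume_cell]
        have : ENNReal.ofReal ((3 : ℝ) ^ k)⁻¹ = 3 * ENNReal.ofReal ((3 : ℝ) ^ (k + 1))⁻¹ := by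
          rw [← ENNReal.ofReal_ofNat 3, ← ENNReal.ofReal_mul (by norm_num), pow_succ]
          congr 1
          field_simp
        rw [this]
        ring

lemma setLIntegral_le_of_cells {k : ℕ} {B : Set ℝ}
    (hB : ∀ x ∈ B, ∀ y, cell k y = cell k x → y ∈ B) {g : ℝ → ENNReal} {C : ENNReal}
    (h : ∀ x ∈ B, ∫⁻ y in {y | cell k y = cell k x}, g y
      ≤ C * volume {y | cell k y = cell k x}) :
    MeasurableSet B ∧ ∫⁻ y in B, g y ≤ C * volume B := by
  have hU : B = ⋃ j ∈ cell k '' B, {y | cell k y = j} := by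
    ext x
    simp only [mem_iUnion, mem_ofPred_eq, exists_prop, exists_eq_right', mem_image]
    exact ⟨fun hx => ⟨x, hx, rfl⟩, fun ⟨y, hy, hyx⟩ => hB y hy x hyx.symm⟩
  have hc : (cell k '' B).Countable := to_countable _
  have hd : (cell k '' B).PairwiseDisjoint fun j => {y | cell k y = j} := by
    intro i _ j _ hij
    exact Set.disjoint_left.2 fun y hy hy' => hij (hy.symm.trans hy')
  have hm : ∀ j ∈ cell k '' B, MeasurableSet {y | cell k y = j} := fun j _ => measurableSet_cell k j
  refine ⟨hU ▸ MeasurableSet.biUnion hc hm, ?_⟩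
  calc ∫⁻ y in B, g y = ∑' j : cell k '' B, ∫⁻ y in {y | cell k y = j}, g y := by
        conv_lhs => rw [hU]
        rw [lintegral_biUnion hc hm hd]
    _ ≤ ∑' j : cell k '' B, C * volume {y | cell k y = j} := by
        refine ENNReal.tsum_le_tsum ?_
        rintro ⟨_, x, hx, rfl⟩
        exact h x hx
    _ = C * volume B := by
        rw [ENNReal.tsum_mul_left, ← measure_biUnion hc hd hm, ← hU]

lemma lintegral_cnt (n : ℕ) (θ : ℝ) :
    ∫⁻ x, (cnt ((3 : ℝ) ^ n)⁻¹ n θ x : ENNReal) = 2 := by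
  simp_rw [cnt_eq_sum]
  push_cast
  have hS : ∀ w : Fin n → Fin 3, {x | |x - pt n θ w| ≤ ((3 : ℝ) ^ n)⁻¹}
      = Icc (pt n θ w - ((3 : ℝ) ^ n)⁻¹) (pt n θ w + ((3 : ℝ) ^ n)⁻¹) := by
    intro w
    ext x
    simp only [mem_ofPred_eq, mem_Icc, abs_le]
    constructor <;> rintro ⟨h1, h2⟩ <;> constructor <;> linarith
  have h : ∀ w : Fin n → Fin 3,
      (fun x => if |x - pt n θ w| ≤ ((3 : ℝ) ^ n)⁻¹ then (1 : ENNReal) else 0)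
        = (Icc (pt n θ w - ((3 : ℝ) ^ n)⁻¹) (pt n θ w + ((3 : ℝ) ^ n)⁻¹)).indicator 1 := by
    intro w
    rw [← hS]
    ext x
    simp [indicator_apply]
  rw [lintegral_finsetSum]
  · have : ∀ w : Fin n → Fin 3, ∫⁻ x, (if |x - pt n θ w| ≤ ((3 : ℝ) ^ n)⁻¹ then (1 : ENNReal) else 0)
        = ENNReal.ofReal (2 * ((3 : ℝ) ^ n)⁻¹) := by
      intro w
      rw [h, lintegral_indicator_one measurableSet_Icc, Real.volume_Icc]
      congr 1
      ring
    simp_rw [this]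
    rw [Finset.sum_const, nsmul_eq_mul, ← ENNReal.ofReal_natCast,
      ← ENNReal.ofReal_mul (by positivity), ← ENNReal.ofReal_ofNat 2]
    congr 1
    simp
    field_simp
  · intro w _
    rw [h]
    exact measurable_one.indicator measurableSet_Icc

/-- Strong induction on `n`, stopping at the first generation where the stack reaches `2κ`. Stopped
cells contribute by self-similarity and the bound for a smaller level. Their union lies in the set
of measure at most `κ^{-3}`, which cancels the factor `κ³`. Elsewhere the count is `O(κ)` and its
integral is `2`. -/
theorem lintegral_cnt_sq_le {κ θ : ℝ} {N : ℕ} (hκ : 216 ≤ κ)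
    (hE : volume {x | κ ≤ fMax N θ x} ≤ ENNReal.ofReal (κ ^ (-3 : ℝ))) (n : ℕ) (hn : n ≤ N) :
    ∫⁻ x, (cnt ((3 : ℝ) ^ n)⁻¹ n θ x : ENNReal) ^ 2 ≤ ENNReal.ofReal (24 * κ) := by
  induction n using Nat.strong_induction_on with
  | _ n ih =>
  -- The threshold is `2κ` because `f` is half the count.
  let B : ℕ → Set ℝ := fun k => {x | 2 * κ ≤ stack k θ x ∧ ∀ i < k, (stack i θ x : ℝ) < 2 * κ}
  have hstack : ∀ k, ∀ x ∈ B k, (stack k θ x : ℝ) ≤ 6 * κ := by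
    rintro (_ | k) x ⟨-, h2⟩
    · have : (stack 0 θ x : ℝ) ≤ 1 := by exact_mod_cast cnt_zero_le _ _ _
      linarith
    · have h3 : (stack (k + 1) θ x : ℝ) ≤ 3 * stack k θ x := by exact_mod_cast stack_succ_le k θ x
      have := h2 k (Nat.lt_succ_self k)
      linarith
  have hB : ∀ k < n, MeasurableSet (B k) ∧
      ∫⁻ y in B k, (cnt ((3 : ℝ) ^ n)⁻¹ n θ y : ENNReal) ^ 2
        ≤ ENNReal.ofReal (2592 * κ ^ 3) * volume (B k) := by
    intro k hk
    refine setLIntegral_le_of_cells (k := k) ?_ ?_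
    · rintro x ⟨h1, h2⟩ y hy
      refine ⟨by rwa [stack_eq_of_le le_rfl θ hy], fun i hi => ?_⟩
      rw [stack_eq_of_le hi.le θ hy]
      exact h2 i hi
    · intro x hx
      obtain ⟨r, rfl⟩ := Nat.exists_eq_add_of_le hk.le
      -- Needed so that the remaining level `r = n - k` is smaller than `n` and the induction
      -- hypothesis applies.
      have hk0 : k ≠ 0 := by
        rintro rfl
        have : (stack 0 θ x : ℝ) ≤ 1 := by exact_mod_cast cnt_zero_le _ _ _
        have := hx.1
        linarith
      have h1 : (stack k θ x : ENNReal) ≤ ENNReal.ofReal (6 * κ) := by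
        rw [← ENNReal.ofReal_natCast]
        exact ENNReal.ofReal_le_ofReal (hstack k x hx)
      refine (setLIntegral_cell_le k (by omega) θ x h1 (ih r (by omega) (by omega))).trans
        (le_of_eq ?_)
      congr 1
      rw [← ENNReal.ofReal_pow (by positivity), ← ENNReal.ofReal_ofNat 3,
        ← ENNReal.ofReal_mul (by norm_num), ← ENNReal.ofReal_mul (by positivity)]
      congr 1
      ring
  have hd : (Finset.range n : Set ℕ).PairwiseDisjoint B := by
    intro i _ j _ hij
    refine Set.disjoint_left.2 fun x hi hj => ?_
    rcases lt_or_gt_of_ne hij with h | h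
    · exact absurd hi.1 (not_le.2 (hj.2 i h))
    · exact absurd hj.1 (not_le.2 (hi.2 j h))
  have hm : ∀ k ∈ Finset.range n, MeasurableSet (B k) := fun k hk => (hB k (Finset.mem_range.1 hk)).1
  have hBA : (⋃ k ∈ Finset.range n, B k) ⊆ {x | κ ≤ fMax N θ x} := by
    intro x hx
    simp only [mem_iUnion, Finset.mem_range] at hx
    obtain ⟨k, hk, hx⟩ := hx
    refine (le_fMax_iff N θ x κ).2 ⟨k, by omega, ?_⟩
    rw [f_eq]
    have h1 : (stack k θ x : ℝ) ≤ cnt ((3 : ℝ) ^ k)⁻¹ k θ x := by exact_mod_cast stack_le_cnt k θ x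
    have := hx.1
    linarith
  have hcompl : ∀ x ∉ ⋃ k ∈ Finset.range n, B k, (cnt ((3 : ℝ) ^ n)⁻¹ n θ x : ℝ) ≤ 6 * κ := by
    intro x hx
    have hlt : ∀ k < n, (stack k θ x : ℝ) < 2 * κ := by
      intro k
      induction k using Nat.strong_induction_on with
      | _ k ihk =>
      intro hk
      by_contra hcon
      refine hx ?_
      simp only [mem_iUnion, Finset.mem_range]
      exact ⟨k, hk, not_lt.1 hcon, fun i hi => ihk i hi (hi.trans hk)⟩
    rcases n with _ | n
    · have : (cnt ((3 : ℝ) ^ 0)⁻¹ 0 θ x : ℝ) ≤ 1 := by exact_mod_cast cnt_zero_le _ _ _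
      linarith
    · have h3 : (cnt ((3 : ℝ) ^ (n + 1))⁻¹ (n + 1) θ x : ℝ) ≤ 3 * stack n θ x := by
        exact_mod_cast cnt_succ_le_stack n θ x
      have := hlt n (Nat.lt_succ_self n)
      linarith
  have hmU : MeasurableSet (⋃ k ∈ Finset.range n, B k) := Finset.measurableSet_biUnion _ hm
  rw [← lintegral_add_compl _ hmU]
  have h1 : ∫⁻ x in ⋃ k ∈ Finset.range n, B k, (cnt ((3 : ℝ) ^ n)⁻¹ n θ x : ENNReal) ^ 2
      ≤ ENNReal.ofReal 2592 := by
    rw [lintegral_biUnion_finset hd hm]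
    calc _ ≤ ∑ k ∈ Finset.range n, ENNReal.ofReal (2592 * κ ^ 3) * volume (B k) :=
          Finset.sum_le_sum fun k hk => (hB k (Finset.mem_range.1 hk)).2
      _ = ENNReal.ofReal (2592 * κ ^ 3) * volume (⋃ k ∈ Finset.range n, B k) := by
          rw [← Finset.mul_sum, measure_biUnion_finset hd hm]
      _ ≤ ENNReal.ofReal (2592 * κ ^ 3) * ENNReal.ofReal (κ ^ (-3 : ℝ)) := by
          gcongr
          exact (measure_mono hBA).trans hE
      _ = ENNReal.ofReal 2592 := by
          rw [← ENNReal.ofReal_mul (by positivity)]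
          congr 1
          rw [Real.rpow_neg (by positivity)]
          norm_cast
          field_simp
  have h2 : ∫⁻ x in (⋃ k ∈ Finset.range n, B k)ᶜ, (cnt ((3 : ℝ) ^ n)⁻¹ n θ x : ENNReal) ^ 2
      ≤ ENNReal.ofReal (12 * κ) := by
    calc _ ≤ ∫⁻ x in (⋃ k ∈ Finset.range n, B k)ᶜ,
            ENNReal.ofReal (6 * κ) * (cnt ((3 : ℝ) ^ n)⁻¹ n θ x : ENNReal) := by
          refine setLIntegral_mono' hmU.compl fun x hx => ?_
          rw [sq]
          gcongr
          rw [← ENNReal.ofReal_natCast]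
          exact ENNReal.ofReal_le_ofReal (hcompl x hx)
      _ ≤ ∫⁻ x, ENNReal.ofReal (6 * κ) * (cnt ((3 : ℝ) ^ n)⁻¹ n θ x : ENNReal) :=
          setLIntegral_le_lintegral _ _
      _ = ENNReal.ofReal (12 * κ) := by
          rw [lintegral_const_mul' _ _ ENNReal.ofReal_ne_top, lintegral_cnt, ← ENNReal.ofReal_ofNat 2,
            ← ENNReal.ofReal_mul (by positivity)]
          congr 1
          ring
  -- The induction closes because `2592 + 12κ ≤ 24κ` exactly when `κ ≥ 216`.
  refine (add_le_add h1 h2).trans ?_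
  rw [← ENNReal.ofReal_add (by norm_num) (by positivity)]
  exact ENNReal.ofReal_le_ofReal (by linarith)

/-! ### From the `L²` bound to sums over pairs of atoms -/

/-- The autocorrelation of the count at any shift `h` is at most its value at `0`, the `L²` norm
squared. Each counted pair contributes at least `3^{-n}` to it, since two intervals of radius `r`
with centres at distance at most `r` overlap in length at least `r`. -/
lemma card_pairs_le {κ θ : ℝ} {n : ℕ} (hκ : 0 ≤ κ)
    (h2 : ∫⁻ x, (cnt ((3 : ℝ) ^ n)⁻¹ n θ x : ENNReal) ^ 2 ≤ ENNReal.ofReal (24 * κ)) (h : ℝ) :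
    ((∑ w : Fin n → Fin 3, ∑ w' : Fin n → Fin 3,
      if |pt n θ w - pt n θ w' + h| ≤ ((3 : ℝ) ^ n)⁻¹ then 1 else 0 : ℕ) : ℝ)
      ≤ 24 * κ * 3 ^ n := by
  set r := ((3 : ℝ) ^ n)⁻¹ with hr
  have hr0 : 0 < r := by positivity
  let F : (Fin n → Fin 3) → (Fin n → Fin 3) → ℝ → ENNReal := fun w w' x =>
    if |x - pt n θ w| ≤ r ∧ |x + h - pt n θ w'| ≤ r then 1 else 0
  have hS : ∀ w w', {x | |x - pt n θ w| ≤ r ∧ |x + h - pt n θ w'| ≤ r}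
      = Icc (max (pt n θ w) (pt n θ w' - h) - r) (min (pt n θ w) (pt n θ w' - h) + r) := by
    intro w w'
    ext x
    simp only [mem_ofPred_eq, mem_Icc, abs_le]
    constructor
    · rintro ⟨⟨h1, h2⟩, h3, h4⟩
      exact ⟨sub_le_iff_le_add.2 (max_le (by linarith) (by linarith)),
        sub_le_iff_le_add.1 (le_min (by linarith) (by linarith))⟩
    · rintro ⟨h1, h2⟩
      have h3 := le_max_left (pt n θ w) (pt n θ w' - h)
      have h4 := le_max_right (pt n θ w) (pt n θ w' - h)
      have h5 := min_le_left (pt n θ w) (pt n θ w' - h)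
      have h6 := min_le_right (pt n θ w) (pt n θ w' - h)
      refine ⟨⟨?_, ?_⟩, ?_, ?_⟩ <;> linarith
  have hF : ∀ w w', F w w' = (Icc (max (pt n θ w) (pt n θ w' - h) - r)
      (min (pt n θ w) (pt n θ w' - h) + r)).indicator 1 := by
    intro w w'
    rw [← hS]
    ext x
    simp [F, indicator_apply]
  have hFm : ∀ w w', Measurable (F w w') := by
    intro w w'
    rw [hF]
    exact measurable_one.indicator measurableSet_Icc
  have hlow : ∀ w w', ((if |pt n θ w - pt n θ w' + h| ≤ r then 1 else 0 : ℕ) : ENNReal)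
      * ENNReal.ofReal r ≤ ∫⁻ x, F w w' x := by
    intro w w'
    split_ifs with hw
    · rw [hF, lintegral_indicator_one measurableSet_Icc, Real.volume_Icc, Nat.cast_one, one_mul]
      refine ENNReal.ofReal_le_ofReal ?_
      have h3 : min (pt n θ w) (pt n θ w' - h) = max (pt n θ w) (pt n θ w' - h)
          - |pt n θ w - (pt n θ w' - h)| := by
        rw [← max_sub_min_eq_abs']; ring
      rw [show pt n θ w - (pt n θ w' - h) = pt n θ w - pt n θ w' + h by ring] at h3
      linarith
    · simp
  have hprod : ∀ x, ∑ w, ∑ w', F w w' x = (cnt r n θ x : ENNReal) * cnt r n θ (x + h) := by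
    intro x
    rw [cnt_eq_sum, cnt_eq_sum]
    push_cast
    rw [Finset.sum_mul_sum]
    refine Finset.sum_congr rfl fun w _ => Finset.sum_congr rfl fun w' _ => ?_
    simp only [F]
    by_cases h1 : |x - pt n θ w| ≤ r <;> by_cases h2 : |x + h - pt n θ w'| ≤ r <;> simp [h1, h2]
  have hm : Measurable fun y => (cnt r n θ y : ENNReal) ^ 2 :=
    ((measurable_from_top (f := fun n : ℕ => (n : ENNReal))).comp
      (measurable_cnt_right _ n θ)).pow_const 2
  have hmain : ((∑ w : Fin n → Fin 3, ∑ w' : Fin n → Fin 3,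
      if |pt n θ w - pt n θ w' + h| ≤ r then 1 else 0 : ℕ) : ENNReal) * ENNReal.ofReal r * 2
      ≤ ENNReal.ofReal (24 * κ) * 2 := by
    calc _ ≤ (∑ w, ∑ w', ∫⁻ x, F w w' x) * 2 := by
          gcongr
          push_cast
          simp_rw [Finset.sum_mul]
          refine Finset.sum_le_sum fun w _ => Finset.sum_le_sum fun w' _ => ?_
          exact_mod_cast hlow w w'
      _ = ∫⁻ x, 2 * ((cnt r n θ x : ENNReal) * cnt r n θ (x + h)) := by
          rw [lintegral_const_mul' _ _ (by simp), mul_comm]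
          congr 1
          simp_rw [← hprod]
          rw [lintegral_finsetSum _ fun w _ => Finset.measurable_fun_sum _ fun w' _ => hFm w w']
          refine Finset.sum_congr rfl fun w _ => ?_
          rw [lintegral_finsetSum _ fun w' _ => hFm w w']
      _ ≤ ∫⁻ x, ((cnt r n θ x : ENNReal) ^ 2 + (cnt r n θ (x + h) : ENNReal) ^ 2) := by
          refine lintegral_mono fun x => ?_
          have := two_mul_le_add_sq (cnt r n θ x : ℝ) (cnt r n θ (x + h))
          rw [mul_assoc] at this
          have h4 : 2 * (cnt r n θ x * cnt r n θ (x + h))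
              ≤ cnt r n θ x ^ 2 + cnt r n θ (x + h) ^ 2 := by exact_mod_cast this
          have h5 := Nat.cast_le (α := ENNReal).2 h4
          push_cast at h5
          exact h5
      _ = 2 * ∫⁻ x, (cnt r n θ x : ENNReal) ^ 2 := by
          rw [lintegral_add_left hm,
            lintegral_add_right_eq_self (fun x => (cnt r n θ x : ENNReal) ^ 2) h, two_mul]
      _ ≤ _ := by
          rw [mul_comm]
          gcongr
  rw [ENNReal.mul_le_mul_iff_left (by simp) (by simp), ← ENNReal.ofReal_natCast,
    ← ENNReal.ofReal_mul (by positivity), ENNReal.ofReal_le_ofReal_iff (by positivity), hr,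
    ← div_eq_mul_inv, div_le_iff₀ (by positivity)] at hmain
  exact hmain

/-- On the window of length `2`, `1 + h² ≤ 3 (1 + u²)`. This writes the kernel `(1 + u²)⁻¹` as a
superposition of unit windows, to which `card_pairs_le` applies shift by shift. -/
lemma two_thirds_mul_le_integral (u : ℝ) :
    2 / 3 * (1 + u ^ 2)⁻¹ ≤ ∫ h, (if |u + h| ≤ 1 then (1 + h ^ 2)⁻¹ else 0) := by
  have h1 : (fun h : ℝ => if |u + h| ≤ 1 then (1 + h ^ 2)⁻¹ else 0)
      = (Icc (-u - 1) (-u + 1)).indicator fun h => (1 + h ^ 2)⁻¹ := by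
    ext h
    rw [indicator_apply]
    have : |u + h| ≤ 1 ↔ h ∈ Icc (-u - 1) (-u + 1) := by
      rw [abs_le, mem_Icc]
      constructor <;> rintro ⟨h1, h2⟩ <;> constructor <;> linarith
    simp only [this]
  rw [h1, integral_indicator measurableSet_Icc]
  have h2 : ∫ _ in Icc (-u - 1) (-u + 1), (3 * (1 + u ^ 2))⁻¹ = 2 / 3 * (1 + u ^ 2)⁻¹ := by
    rw [setIntegral_const, measureReal_def, Real.volume_Icc, ENNReal.toReal_ofReal (by linarith),
      smul_eq_mul, mul_inv]
    ring
  rw [← h2]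
  refine setIntegral_mono_on (integrableOn_const (by simp)) integrable_inv_one_add_sq.integrableOn
    measurableSet_Icc fun h hh => ?_
  refine inv_anti₀ (by positivity) ?_
  have h3 : |u + h| ≤ 1 := by
    rw [abs_le]; constructor <;> linarith [hh.1, hh.2]
  nlinarith [sq_abs (u + h), abs_nonneg (u + h), sq_nonneg (2 * u + h)]

lemma sum_inv_one_add_sq_le {κ θ : ℝ} {n : ℕ} (hκ : 0 ≤ κ)
    (h2 : ∫⁻ x, (cnt ((3 : ℝ) ^ n)⁻¹ n θ x : ENNReal) ^ 2 ≤ ENNReal.ofReal (24 * κ)) :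
    ∑ w : Fin n → Fin 3, ∑ w' : Fin n → Fin 3,
      (1 + ((3 : ℝ) ^ n * (pt n θ w - pt n θ w')) ^ 2)⁻¹ ≤ 36 * Real.pi * κ * 3 ^ n := by
  let G : (Fin n → Fin 3) → (Fin n → Fin 3) → ℝ → ℝ := fun w w' h =>
    if |(3 : ℝ) ^ n * (pt n θ w - pt n θ w') + h| ≤ 1 then (1 + h ^ 2)⁻¹ else 0
  have hGi : ∀ w w', Integrable (G w w') := by
    intro w w'
    have hm : MeasurableSet {h : ℝ | |(3 : ℝ) ^ n * (pt n θ w - pt n θ w') + h| ≤ 1} :=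
      measurableSet_le (by fun_prop) measurable_const
    exact (integrable_inv_one_add_sq.indicator hm).congr
      (Filter.Eventually.of_forall fun h => by simp [G, indicator_apply])
  have hsum : ∀ h, ∑ w, ∑ w', G w w' h ≤ 24 * κ * 3 ^ n * (1 + h ^ 2)⁻¹ := by
    intro h
    have := card_pairs_le hκ h2 (((3 : ℝ) ^ n)⁻¹ * h)
    refine le_trans (le_of_eq ?_) (mul_le_mul_of_nonneg_right this (by positivity))
    push_cast
    simp_rw [Finset.sum_mul]
    refine Finset.sum_congr rfl fun w _ => Finset.sum_congr rfl fun w' _ => ?_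
    have h3 : |pt n θ w - pt n θ w' + ((3 : ℝ) ^ n)⁻¹ * h| ≤ ((3 : ℝ) ^ n)⁻¹
        ↔ |(3 : ℝ) ^ n * (pt n θ w - pt n θ w') + h| ≤ 1 := by
      have h4 : (3 : ℝ) ^ n * (pt n θ w - pt n θ w') + h
          = (pt n θ w - pt n θ w' + ((3 : ℝ) ^ n)⁻¹ * h) * 3 ^ n := by field_simp
      rw [h4, abs_mul, abs_of_pos (a := (3 : ℝ) ^ n) (by positivity), ← le_div_iff₀ (by positivity),
        one_div]
    simp only [G, h3]
    split_ifs <;> simp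
  have key : 2 / 3 * ∑ w : Fin n → Fin 3, ∑ w' : Fin n → Fin 3,
      (1 + ((3 : ℝ) ^ n * (pt n θ w - pt n θ w')) ^ 2)⁻¹ ≤ 24 * κ * 3 ^ n * Real.pi := by
    calc _ ≤ ∑ w, ∑ w', ∫ h, G w w' h := by
          simp_rw [Finset.mul_sum]
          exact Finset.sum_le_sum fun w _ => Finset.sum_le_sum fun w' _ =>
            two_thirds_mul_le_integral _
      _ = ∫ h, ∑ w, ∑ w', G w w' h := by
          rw [integral_finsetSum _ fun w _ => integrable_finsetSum _ fun w' _ => hGi w w']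
          refine Finset.sum_congr rfl fun w _ => ?_
          rw [integral_finsetSum _ fun w' _ => hGi w w']
      _ ≤ ∫ h, 24 * κ * 3 ^ n * (1 + h ^ 2)⁻¹ :=
          integral_mono (integrable_finsetSum _ fun w _ => integrable_finsetSum _ fun w' _ =>
            hGi w w') (integrable_inv_one_add_sq.const_mul _) hsum
      _ = _ := by rw [integral_const_mul, integral_univ_inv_one_add_sq]
  linarith

/-! ### The Fejér weight `T - x` and mean values of partial products -/

lemma integral_sub_mul_cos {T b : ℝ} (hb : b ≠ 0) :
    ∫ x in (0 : ℝ)..T, (T - x) * Real.cos (b * x) = (1 - Real.cos (b * T)) / b ^ 2 := by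
  have hd : ∀ x ∈ uIcc 0 T, HasDerivAt
      (fun x => (T - x) * Real.sin (b * x) / b - Real.cos (b * x) / b ^ 2)
      ((T - x) * Real.cos (b * x)) x := by
    intro x _
    have h1 : HasDerivAt (fun x => b * x) b x := by simpa using (hasDerivAt_id x).const_mul b
    have h2 := (((hasDerivAt_id x).const_sub T).mul h1.sin).div_const b
    have h3 := h1.cos.div_const (b ^ 2)
    refine (h2.sub h3).congr_deriv ?_
    simp only [id]
    field_simp
    ring
  rw [intervalIntegral.integral_eq_sub_of_hasDerivAt hd
    (Continuous.intervalIntegrable (by fun_prop) _ _)]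
  simp
  ring

lemma integral_sub_id (T : ℝ) : ∫ x in (0 : ℝ)..T, (T - x) = T ^ 2 / 2 := by
  rw [intervalIntegral.integral_sub (by simp) (by simp)]
  simp
  ring

lemma integral_sub_mul_cos_nonneg (T b : ℝ) :
    0 ≤ ∫ x in (0 : ℝ)..T, (T - x) * Real.cos (b * x) := by
  rcases eq_or_ne b 0 with rfl | hb
  · simp only [zero_mul, Real.cos_zero, mul_one]
    rw [integral_sub_id]
    positivity
  · rw [integral_sub_mul_cos hb]
    have := Real.cos_le_one (b * T)
    exact div_nonneg (by linarith) (by positivity)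

lemma integral_sub_mul_cos_le (T b : ℝ) :
    ∫ x in (0 : ℝ)..T, (T - x) * Real.cos (b * x) ≤ 5 / 2 * T ^ 2 * (1 + (b * T) ^ 2)⁻¹ := by
  rcases eq_or_ne b 0 with rfl | hb
  · simp only [zero_mul, Real.cos_zero, mul_one]
    rw [integral_sub_id]
    norm_num
    nlinarith [sq_nonneg T]
  · rw [integral_sub_mul_cos hb, ← div_eq_mul_inv, div_le_div_iff₀ (by positivity) (by positivity)]
    have h1 := Real.one_sub_sq_div_two_le_cos (x := b * T)
    have h2 := Real.neg_one_le_cos (b * T)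
    nlinarith [sq_nonneg (b * T)]

/-- The partial product `∏_{k<l} |φ_θ(3^{-k} x)|²`. -/
noncomputable def partialProd (l : ℕ) (θ x : ℝ) : ℝ :=
  ∏ k ∈ Finset.range l, ‖phi θ (((3 : ℝ) ^ k)⁻¹ * x)‖ ^ 2

lemma continuous_partialProd (l : ℕ) : Continuous fun p : ℝ × ℝ => partialProd l p.1 p.2 := by
  refine continuous_finsetProd _ fun k _ => ?_
  have h : Continuous fun p : ℝ × ℝ => (p.1, ((3 : ℝ) ^ k)⁻¹ * p.2) := by fun_prop
  exact (continuous_phi.comp h).norm.pow 2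

lemma continuous_partialProd_right (l : ℕ) (θ : ℝ) : Continuous fun x => partialProd l θ x := by
  have h : Continuous fun x : ℝ => (θ, x) := by fun_prop
  have h2 := (continuous_partialProd l).comp h
  simpa only [Function.comp_def] using h2

lemma partialProd_nonneg (l : ℕ) (θ x : ℝ) : 0 ≤ partialProd l θ x :=
  Finset.prod_nonneg fun _ _ => by positivity

lemma integral_sub_mul_partialProd (l : ℕ) (θ T : ℝ) :
    ∫ x in (0 : ℝ)..T, (T - x) * partialProd l θ x
      = ((9 : ℝ) ^ l)⁻¹ * ∑ w : Fin l → Fin 3, ∑ w' : Fin l → Fin 3,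
        ∫ x in (0 : ℝ)..T, (T - x) * Real.cos (3 * (pt l θ w - pt l θ w') * x) := by
  have hi : ∀ w w' : Fin l → Fin 3, IntervalIntegrable
      (fun x => (T - x) * Real.cos (3 * (pt l θ w - pt l θ w') * x)) volume 0 T :=
    fun w w' => Continuous.intervalIntegrable (by fun_prop) _ _
  have hi' : ∀ w : Fin l → Fin 3, IntervalIntegrable
      (fun x => ∑ w', (T - x) * Real.cos (3 * (pt l θ w - pt l θ w') * x)) volume 0 T :=
    fun w => Continuous.intervalIntegrable (by fun_prop) _ _
  have h : ∀ x, (T - x) * partialProd l θ x = ((9 : ℝ) ^ l)⁻¹ *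
      ∑ w : Fin l → Fin 3, ∑ w' : Fin l → Fin 3,
        (T - x) * Real.cos (3 * (pt l θ w - pt l θ w') * x) := by
    intro x
    rw [partialProd, prod_sq_phi_eq]
    simp_rw [← Finset.mul_sum]
    ring
  simp_rw [h]
  rw [intervalIntegral.integral_const_mul, intervalIntegral.integral_finsetSum fun w _ => hi' w]
  congr 1
  refine Finset.sum_congr rfl fun w _ => ?_
  rw [intervalIntegral.integral_finsetSum fun w' _ => hi w w']

/-- With the weight `T - x` every term of the double sum is nonnegative, so the `3^l` diagonal terms
`T² / 2` bound it from below. -/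
lemma le_integral_partialProd (l : ℕ) (θ : ℝ) {T : ℝ} (hT : 0 < T) :
    ((3 : ℝ) ^ l)⁻¹ * T / 2 ≤ ∫ x in (0 : ℝ)..T, partialProd l θ x := by
  have h1 : ∫ x in (0 : ℝ)..T, (T - x) * partialProd l θ x
      ≤ ∫ x in (0 : ℝ)..T, T * partialProd l θ x := by
    have hc := continuous_partialProd_right l θ
    refine intervalIntegral.integral_mono_on hT.le
      (Continuous.intervalIntegrable (by fun_prop) _ _)
      (Continuous.intervalIntegrable (by fun_prop) _ _) fun x hx => ?_
    exact mul_le_mul_of_nonneg_right (by linarith [hx.1]) (partialProd_nonneg l θ x)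
  rw [intervalIntegral.integral_const_mul, integral_sub_mul_partialProd] at h1
  have h2 : (3 : ℝ) ^ l * (T ^ 2 / 2) ≤ ∑ w : Fin l → Fin 3, ∑ w' : Fin l → Fin 3,
        ∫ x in (0 : ℝ)..T, (T - x) * Real.cos (3 * (pt l θ w - pt l θ w') * x) := by
    have h3 : ∑ _w : Fin l → Fin 3, T ^ 2 / 2 = (3 : ℝ) ^ l * (T ^ 2 / 2) := by
      simp
    rw [← h3]
    refine Finset.sum_le_sum fun w _ => ?_
    refine le_trans (le_of_eq ?_) (Finset.single_le_sum
      (fun w' _ => integral_sub_mul_cos_nonneg T _) (Finset.mem_univ w))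
    simp only [sub_self, mul_zero, zero_mul, Real.cos_zero, mul_one]
    rw [integral_sub_id]
  have h4 : ((9 : ℝ) ^ l)⁻¹ * ((3 : ℝ) ^ l * (T ^ 2 / 2)) = T * (((3 : ℝ) ^ l)⁻¹ * T / 2) := by
    rw [show (9 : ℝ) = 3 * 3 by norm_num, mul_pow]
    field_simp
  have h5 := mul_le_mul_of_nonneg_left h2 (a := ((9 : ℝ) ^ l)⁻¹) (by positivity)
  rw [h4] at h5
  exact le_of_mul_le_mul_left (h5.trans h1) hT

lemma integral_partialProd_le {κ θ : ℝ} {l : ℕ} (hκ : 0 ≤ κ)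
    (h2 : ∫⁻ x, (cnt ((3 : ℝ) ^ l)⁻¹ l θ x : ENNReal) ^ 2 ≤ ENNReal.ofReal (24 * κ)) {t : ℝ}
    (ht : 0 ≤ t) (htl : t ≤ 3 ^ l / 6) :
    ∫ x in (0 : ℝ)..t, partialProd l θ x ≤ 240 * κ := by
  have hc := continuous_partialProd_right l θ
  -- This `T` cancels the `3` in the phase, so the Fejér bound is the kernel of
  -- `sum_inv_one_add_sq_le`. The range `t ≤ T / 2` keeps the weight at least `T / 2`.
  set T : ℝ := 3 ^ l / 3 with hT
  have hT0 : 0 < T := by positivity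
  have hbT : ∀ w w', 3 * (pt l θ w - pt l θ w') * T = 3 ^ l * (pt l θ w - pt l θ w') := by
    intro w w'; rw [hT]; ring
  have htT : t ≤ T := by linarith
  have h1 : T / 2 * ∫ x in (0 : ℝ)..t, partialProd l θ x
      ≤ ∫ x in (0 : ℝ)..T, (T - x) * partialProd l θ x := by
    have h3 : T / 2 * ∫ x in (0 : ℝ)..t, partialProd l θ x
        ≤ ∫ x in (0 : ℝ)..t, (T - x) * partialProd l θ x := by
      rw [← intervalIntegral.integral_const_mul]
      refine intervalIntegral.integral_mono_on ht
        (Continuous.intervalIntegrable (by fun_prop) _ _)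
        (Continuous.intervalIntegrable (by fun_prop) _ _) fun x hx => ?_
      exact mul_le_mul_of_nonneg_right (by linarith [hx.2]) (partialProd_nonneg l θ x)
    have h4 : 0 ≤ ∫ x in t..T, (T - x) * partialProd l θ x :=
      intervalIntegral.integral_nonneg htT fun x hx =>
        mul_nonneg (by linarith [hx.2]) (partialProd_nonneg l θ x)
    rw [← intervalIntegral.integral_add_adjacent_intervals
      (Continuous.intervalIntegrable (by fun_prop) 0 t)
      (Continuous.intervalIntegrable (by fun_prop) t T)]
    linarith
  have h3 : ∫ x in (0 : ℝ)..T, (T - x) * partialProd l θ x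
      ≤ ((9 : ℝ) ^ l)⁻¹ * (5 / 2 * T ^ 2 * (36 * Real.pi * κ * 3 ^ l)) := by
    rw [integral_sub_mul_partialProd]
    refine mul_le_mul_of_nonneg_left ?_ (by positivity)
    refine le_trans ?_ (mul_le_mul_of_nonneg_left (sum_inv_one_add_sq_le hκ h2) (by positivity))
    simp_rw [Finset.mul_sum]
    refine Finset.sum_le_sum fun w _ => Finset.sum_le_sum fun w' _ => ?_
    rw [← hbT]
    exact integral_sub_mul_cos_le _ _
  have h4 : ((9 : ℝ) ^ l)⁻¹ * (5 / 2 * T ^ 2 * (36 * Real.pi * κ * 3 ^ l))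
      = T / 2 * (60 * Real.pi * κ) := by
    rw [show (9 : ℝ) = 3 * 3 by norm_num, mul_pow, hT]
    field_simp
    ring
  rw [h4] at h3
  have h5 := le_of_mul_le_mul_left (h1.trans h3) (by positivity)
  have h6 := mul_le_mul_of_nonneg_right Real.pi_le_four hκ
  linarith

/-! ### Pointwise behaviour of `φ_θ` under tripling -/

lemma sq_norm_phi_eq (θ y : ℝ) :
    ‖phi θ y‖ ^ 2 = 1 - 2 / 9 * ((1 - Real.cos (y * (vertex θ 0 - vertex θ 1)))
      + (1 - Real.cos (y * (vertex θ 1 - vertex θ 2)))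
      + (1 - Real.cos (y * (vertex θ 0 - vertex θ 2)))) := by
  rw [phi, norm_mul, mul_pow, normSq_sum_exp fun j => y * vertex θ j]
  simp only [Fin.sum_univ_three, ← mul_sub, sub_self, mul_zero, Real.cos_zero]
  rw [← Real.cos_neg (y * (vertex θ 1 - vertex θ 0)), ← Real.cos_neg (y * (vertex θ 2 - vertex θ 1)),
    ← Real.cos_neg (y * (vertex θ 2 - vertex θ 0)), ← mul_neg, ← mul_neg, ← mul_neg,
    neg_sub, neg_sub, neg_sub]
  norm_num
  ring

lemma sq_norm_phi_le_one (θ y : ℝ) : ‖phi θ y‖ ^ 2 ≤ 1 :=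
  pow_le_one₀ (norm_nonneg _) (norm_phi_le_one θ y)

/-- `1 - cos 3t = (1 - cos t)(1 + 2 cos t)²`. -/
lemma one_sub_cos_three_mul_le (t : ℝ) : 1 - Real.cos (3 * t) ≤ 9 * (1 - Real.cos t) := by
  rw [Real.cos_three_mul]
  nlinarith [mul_nonneg (sq_nonneg (Real.cos t - 1))
    (show 0 ≤ Real.cos t + 2 by linarith [Real.neg_one_le_cos t])]

lemma one_sub_sq_norm_phi_three_mul_le (θ y : ℝ) :
    1 - ‖phi θ (3 * y)‖ ^ 2 ≤ 9 * (1 - ‖phi θ y‖ ^ 2) := by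
  simp only [sq_norm_phi_eq, mul_assoc 3 y]
  have h1 := one_sub_cos_three_mul_le (y * (vertex θ 0 - vertex θ 1))
  have h2 := one_sub_cos_three_mul_le (y * (vertex θ 1 - vertex θ 2))
  have h3 := one_sub_cos_three_mul_le (y * (vertex θ 0 - vertex θ 2))
  linarith

/-- Newton's identity `a³ + b³ + c³ = 3e₃ - 3e₁e₂ + e₁³`; on the unit circle `e₂ = e₃ · conj e₁`, so
`|e₂| = |e₁|`. When `e₁` is small the points are nearly a rotated triple of cube roots of unity,
whose cubes coincide. -/
lemma norm_sum_cubes_ge {a b c : ℂ} (ha : ‖a‖ = 1) (hb : ‖b‖ = 1) (hc : ‖c‖ = 1) :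
    3 - 3 * ‖a + b + c‖ ^ 2 - ‖a + b + c‖ ^ 3 ≤ ‖a ^ 3 + b ^ 3 + c ^ 3‖ := by
  have hinv : ∀ z : ℂ, ‖z‖ = 1 → z * (starRingEnd ℂ) z = 1 := by
    intro z hz
    rw [Complex.mul_conj, Complex.normSq_eq_norm_sq, hz]
    norm_num
  have he2 : a * b + b * c + a * c = a * b * c * (starRingEnd ℂ) (a + b + c) := by
    simp only [map_add]
    linear_combination -(b * c) * hinv a ha - (a * c) * hinv b hb - (a * b) * hinv c hc
  have hn2 : ‖a * b + b * c + a * c‖ = ‖a + b + c‖ := by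
    rw [he2, norm_mul, norm_mul, norm_mul, ha, hb, hc, Complex.norm_conj]
    ring
  have h : a ^ 3 + b ^ 3 + c ^ 3
      = 3 * (a * b * c) - (3 * ((a + b + c) * (a * b + b * c + a * c)) - (a + b + c) ^ 3) := by
    ring
  rw [h]
  have h1 := norm_sub_norm_le (3 * (a * b * c))
    (3 * ((a + b + c) * (a * b + b * c + a * c)) - (a + b + c) ^ 3)
  have h2 := norm_sub_le (3 * ((a + b + c) * (a * b + b * c + a * c))) ((a + b + c) ^ 3)
  simp only [norm_mul, norm_pow, ha, hb, hc, hn2, Complex.norm_ofNat] at h1 h2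
  nlinarith

lemma one_sub_sq_norm_phi_three_mul_le' (θ y : ℝ) :
    1 - ‖phi θ (3 * y)‖ ^ 2 ≤ 36 * ‖phi θ y‖ ^ 2 := by
  set e : Fin 3 → ℂ := fun j => Complex.exp (-Complex.I * (y * vertex θ j : ℝ)) with he
  have hn : ∀ j, ‖e j‖ = 1 := by
    intro j
    simp only [he, neg_mul, Complex.norm_exp]
    simp
  have h1 : phi θ y = 1 / 3 * (e 0 + e 1 + e 2) := by
    rw [phi, Fin.sum_univ_three]
  have h3 : phi θ (3 * y) = 1 / 3 * (e 0 ^ 3 + e 1 ^ 3 + e 2 ^ 3) := by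
    rw [phi, Fin.sum_univ_three]
    simp only [he, ← Complex.exp_nat_mul]
    push_cast
    ring_nf
  have h := norm_sum_cubes_ge (hn 0) (hn 1) (hn 2)
  have hs : ‖e 0 + e 1 + e 2‖ = 3 * ‖phi θ y‖ := by
    rw [h1, norm_mul]; norm_num; ring
  have hs3 : ‖e 0 ^ 3 + e 1 ^ 3 + e 2 ^ 3‖ = 3 * ‖phi θ (3 * y)‖ := by
    rw [h3, norm_mul]; norm_num; ring
  rw [hs, hs3] at h
  have h4 := norm_phi_le_one θ y
  have h5 := norm_phi_le_one θ (3 * y)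
  have h6 : ‖phi θ y‖ ^ 3 ≤ ‖phi θ y‖ ^ 2 :=
    pow_le_pow_of_le_one (norm_nonneg _) h4 (by norm_num)
  have h7 : 1 - 18 * ‖phi θ y‖ ^ 2 ≤ ‖phi θ (3 * y)‖ := by nlinarith
  nlinarith [norm_nonneg (phi θ (3 * y))]

lemma abs_vertex_sub_le (θ : ℝ) (i j : Fin 3) : |vertex θ i - vertex θ j| ≤ 2 := by
  have h1 := abs_vertex_le θ i
  have h2 := abs_vertex_le θ j
  rw [abs_le] at h1 h2 ⊢
  constructor <;> linarith

lemma one_sub_sq_norm_phi_le (θ y : ℝ) : 1 - ‖phi θ y‖ ^ 2 ≤ 4 / 3 * y ^ 2 := by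
  have h : ∀ i j, 1 - Real.cos (y * (vertex θ i - vertex θ j)) ≤ 2 * y ^ 2 := by
    intro i j
    have h1 := Real.one_sub_sq_div_two_le_cos (x := y * (vertex θ i - vertex θ j))
    have h2 : (vertex θ i - vertex θ j) ^ 2 ≤ 2 ^ 2 := sq_le_sq' (by
      linarith [(abs_le.1 (abs_vertex_sub_le θ i j)).1]) (abs_le.1 (abs_vertex_sub_le θ i j)).2
    rw [mul_pow] at h1
    nlinarith [mul_le_mul_of_nonneg_left h2 (sq_nonneg y)]
  rw [sq_norm_phi_eq]
  linarith [h 0 1, h 1 2, h 0 2]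

/-- A small factor is compensated by the factors near `1` that follow it. -/
lemma prod_mul_max_ge {d : ℝ} (hd : 0 < d) (L : ℕ) (g : ℕ → ℝ)
    (h0 : ∀ k, g k ≤ 1) (h9 : ∀ k, 1 - g (k + 1) ≤ 9 * (1 - g k))
    (h36 : ∀ k, 1 - g (k + 1) ≤ 36 * g k) (hg : ∀ k < L, d ≤ g k) :
    ((81 : ℝ) ^ L)⁻¹ * d ≤ (∏ k ∈ Finset.range L, g k) * max (1 - g 0) d := by
  induction L generalizing g with
  | zero => simp
  | succ L ih =>
    have h := ih (fun k => g (k + 1)) (fun k => h0 _) (fun k => h9 _) (fun k => h36 _)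
      fun k hk => hg (k + 1) (by omega)
    rw [Finset.prod_range_succ']
    simp only [zero_add] at h
    set P := ∏ k ∈ Finset.range L, g (k + 1) with hP
    have hP0 : 0 ≤ P := Finset.prod_nonneg fun k hk =>
      hd.le.trans (hg (k + 1) (by have := Finset.mem_range.1 hk; omega))
    have hg0 : d ≤ g 0 := hg 0 (by omega)
    have h5 : ((81 : ℝ) ^ (L + 1))⁻¹ * d = 1 / 81 * (((81 : ℝ) ^ L)⁻¹ * d) := by
      rw [pow_succ]; field_simp
    rw [h5]
    -- The quantity `max (1 - g) d` serves as a potential: a small factor resets it, and each step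
    -- of the product costs at most `81`. The constant `72` would do, but `81^L = (3^L)^4` is
    -- convenient later.
    have hkey : max (1 - g 1) d ≤ 81 * (g 0 * max (1 - g 0) d) := by
      rcases le_total (1 / 2) (g 0) with h1 | h1
      · have h2 : 9 * max (1 - g 0) d ≤ 81 * (g 0 * max (1 - g 0) d) := by
          have : 0 ≤ max (1 - g 0) d := hd.le.trans (le_max_right _ _)
          nlinarith
        refine le_trans (max_le ?_ ?_) h2
        · exact (h9 0).trans (mul_le_mul_of_nonneg_left (le_max_left _ _) (by norm_num))
        · linarith [le_max_right (1 - g 0) d]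
      · have h2 : 1 / 2 ≤ max (1 - g 0) d := le_max_of_le_left (by linarith)
        have h3 : 36 * g 0 ≤ 81 * (g 0 * max (1 - g 0) d) := by
          nlinarith [mul_le_mul_of_nonneg_left h2 (hd.le.trans hg0)]
        refine le_trans (max_le (h36 0) ?_) h3
        linarith
    have h6 := mul_le_mul_of_nonneg_left hkey hP0
    linarith

lemma prod_range_sq_norm_phi_ge {d : ℝ} (hd : 0 < d) (hd1 : d ≤ 1) (L : ℕ) (θ y : ℝ)
    (hg : ∀ k < L, d ≤ ‖phi θ (3 ^ k * y)‖ ^ 2) :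
    ((81 : ℝ) ^ L)⁻¹ * d ≤ ∏ k ∈ Finset.range L, ‖phi θ (3 ^ k * y)‖ ^ 2 := by
  have hs : ∀ k : ℕ, (3 : ℝ) ^ (k + 1) * y = 3 * (3 ^ k * y) := fun k => by rw [pow_succ]; ring
  have h := prod_mul_max_ge hd L (fun k => ‖phi θ (3 ^ k * y)‖ ^ 2)
    (fun k => sq_norm_phi_le_one _ _)
    (fun k => by simp only [hs]; exact one_sub_sq_norm_phi_three_mul_le _ _)
    (fun k => by simp only [hs]; exact one_sub_sq_norm_phi_three_mul_le' _ _) hg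
  refine h.trans (mul_le_of_le_one_right (Finset.prod_nonneg fun _ _ => by positivity) ?_)
  exact max_le (by linarith [sq_nonneg ‖phi θ (3 ^ 0 * y)‖]) hd1

lemma prod_range_sq_norm_phi_ge_half (L : ℕ) (θ : ℝ) {y : ℝ} (hy : |y| ≤ 1 / 3) :
    1 / 2 ≤ ∏ k ∈ Finset.range L, ‖phi θ (((3 : ℝ) ^ k)⁻¹ * y)‖ ^ 2 := by
  -- The slack is chosen so that the induction is exact: the factor of index `L` loses `4/27 ·
  -- 9^{-L}`, and `1/6 - 4/27 = 1/6 · 1/9`.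
  suffices h : 1 / 2 + 1 / 6 * ((9 : ℝ) ^ L)⁻¹
      ≤ ∏ k ∈ Finset.range L, ‖phi θ (((3 : ℝ) ^ k)⁻¹ * y)‖ ^ 2 by
    have : 0 < ((9 : ℝ) ^ L)⁻¹ := by positivity
    linarith
  induction L with
  | zero => norm_num
  | succ L ih =>
    rw [Finset.prod_range_succ]
    set P := ∏ k ∈ Finset.range L, ‖phi θ (((3 : ℝ) ^ k)⁻¹ * y)‖ ^ 2
    have hP1 : P ≤ 1 := Finset.prod_le_one (fun _ _ => by positivity) fun _ _ =>
      sq_norm_phi_le_one _ _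
    have h1 := one_sub_sq_norm_phi_le θ (((3 : ℝ) ^ L)⁻¹ * y)
    have h2 : (((3 : ℝ) ^ L)⁻¹ * y) ^ 2 ≤ ((9 : ℝ) ^ L)⁻¹ * (1 / 9) := by
      rw [mul_pow, inv_pow, ← pow_mul, mul_comm L 2, pow_mul]
      norm_num only
      refine mul_le_mul_of_nonneg_left ?_ (by positivity)
      rw [← sq_abs]
      nlinarith [abs_nonneg y]
    have h3 : ((9 : ℝ) ^ (L + 1))⁻¹ = 1 / 9 * ((9 : ℝ) ^ L)⁻¹ := by rw [pow_succ]; field_simp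
    rw [h3]
    have h4 : 1 - 4 / 27 * ((9 : ℝ) ^ L)⁻¹ ≤ ‖phi θ (((3 : ℝ) ^ L)⁻¹ * y)‖ ^ 2 := by linarith
    have h5 : 0 < ((9 : ℝ) ^ L)⁻¹ := by positivity
    nlinarith

/-! ### Exceptional directions -/

lemma exists_int_abs_sub_le {t δ : ℝ} (hδ : 0 ≤ δ) (h : 1 - Real.cos t ≤ 162 * δ ^ 2) :
    ∃ p : ℤ, |t - 2 * Real.pi * p| ≤ 36 * δ := by
  have hπ := Real.pi_pos
  refine ⟨round (t / (2 * Real.pi)), ?_⟩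
  set p := round (t / (2 * Real.pi)) with hp
  have h1 : |t - 2 * Real.pi * p| ≤ Real.pi := by
    have h2 := abs_sub_round (t / (2 * Real.pi))
    have h3 : t - 2 * Real.pi * p = 2 * Real.pi * (t / (2 * Real.pi) - p) := by field_simp
    rw [h3, abs_mul, abs_of_pos (by positivity)]
    nlinarith
  have h2 := Real.cos_le_one_sub_mul_cos_sq h1
  rw [show t - 2 * Real.pi * p = t - p * (2 * Real.pi) by ring, Real.cos_sub_int_mul_two_pi,
    show t - p * (2 * Real.pi) = t - 2 * Real.pi * p by ring] at h2
  have h4 : 2 / Real.pi ^ 2 * (t - 2 * Real.pi * p) ^ 2 ≤ 162 * δ ^ 2 := by linarith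
  rw [div_mul_eq_mul_div, div_le_iff₀ (by positivity)] at h4
  have h5 : Real.pi ^ 2 ≤ 4 ^ 2 := pow_le_pow_left₀ hπ.le Real.pi_le_four 2
  refine abs_le_of_sq_le_sq ?_ (by positivity)
  nlinarith [mul_le_mul_of_nonneg_left h5 (sq_nonneg δ)]

lemma vertex_one_sub_two (θ : ℝ) : vertex θ 1 - vertex θ 2 = Real.sqrt 3 * Real.cos θ := by
  simp only [vertex, Matrix.cons_val]
  rw [show 7 * Real.pi / 6 - θ = (Real.pi / 6 - θ) + Real.pi by ring, Real.cos_add_pi,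
    show -Real.pi / 6 - θ = -(Real.pi / 6 + θ) by ring, Real.cos_neg, Real.cos_add, Real.cos_sub,
    Real.cos_pi_div_six]
  ring

lemma vertex_zero_sub_add (θ : ℝ) :
    (vertex θ 0 - vertex θ 1) + (vertex θ 0 - vertex θ 2) = 3 * Real.sin θ := by
  simp only [vertex, Matrix.cons_val]
  rw [show 7 * Real.pi / 6 - θ = (Real.pi / 6 - θ) + Real.pi by ring, Real.cos_add_pi,
    show -Real.pi / 6 - θ = -(Real.pi / 6 + θ) by ring, Real.cos_neg, Real.cos_pi_div_two_sub,
    Real.cos_add, Real.cos_sub, Real.sin_pi_div_six]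
  ring

/-- The directions that are nearly parallel to a short vector of the zero lattice of `φ`. -/
def badSet (R : ℕ) (η : ℝ) : Set ℝ :=
  {θ | θ ∈ Icc 0 Real.pi ∧ ∃ p ∈ Finset.Icc (-(R : ℤ)) R, ∃ r ∈ Finset.Icc (-(R : ℤ)) R,
    (p ≠ 0 ∨ r ≠ 0) ∧ |Real.sqrt 3 * p * Real.sin θ - r * Real.cos θ| ≤ η}

lemma five_thirds_le_sqrt_three : 5 / 3 ≤ Real.sqrt 3 := by
  rw [Real.le_sqrt (by norm_num) (by norm_num)]
  norm_num

lemma sqrt_three_le : Real.sqrt 3 ≤ 7 / 4 := by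
  rw [Real.sqrt_le_left (by norm_num)]
  norm_num

/-- Elimination of `y` between the two near-integrality conditions leaves a condition on `θ` alone.
-/
lemma abs_sqrt_three_mul_sub_le {θ y δ P Q : ℝ}
    (hP : |3 * y * (Real.sqrt 3 * Real.cos θ) - 2 * Real.pi * P| ≤ 36 * δ)
    (hQ : |9 * y * Real.sin θ - 2 * Real.pi * Q| ≤ 72 * δ) :
    |Real.sqrt 3 * P * Real.sin θ - Q * Real.cos θ| ≤ 24 * δ := by
  have hs1 := five_thirds_le_sqrt_three
  have hs2 := sqrt_three_le
  have hss : Real.sqrt 3 ^ 2 = 3 := Real.sq_sqrt (by norm_num)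
  have hcabs := Real.abs_cos_le_one θ
  have hsabs := Real.abs_sin_le_one θ
  generalize Real.sqrt 3 = s at *
  have hs0 : 0 ≤ s := by linarith
  have hπ := Real.pi_gt_three
  set e := 3 * y * (s * Real.cos θ) - 2 * Real.pi * P with he
  set e' := 9 * y * Real.sin θ - 2 * Real.pi * Q with he'
  have h2 : 2 * Real.pi * (3 * s) * (s * P * Real.sin θ - Q * Real.cos θ)
      = 3 * s * Real.cos θ * e' - 9 * Real.sin θ * e := by
    rw [he, he']
    linear_combination (6 * Real.pi * P * Real.sin θ) * hss
  have h3 : |3 * s * Real.cos θ * e' - 9 * Real.sin θ * e| ≤ 720 * δ := by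
    refine (abs_sub _ _).trans ?_
    rw [abs_mul, abs_mul (9 * Real.sin θ), abs_mul, abs_mul 9,
      abs_of_nonneg (a := 3 * s) (by positivity), abs_of_pos (a := (9 : ℝ)) (by norm_num)]
    have h4 : 3 * s * |Real.cos θ| * |e'| ≤ 3 * (7 / 4) * 1 * (72 * δ) := by gcongr
    have h5 : 9 * |Real.sin θ| * |e| ≤ 9 * 1 * (36 * δ) := by gcongr
    have h6 : 0 ≤ δ := by linarith [abs_nonneg e]
    linarith
  rw [← h2, abs_mul, abs_of_nonneg (a := 2 * Real.pi * (3 * s)) (by positivity)] at h3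
  have h6 : 30 ≤ 2 * Real.pi * (3 * s) := by nlinarith
  have h7 := mul_le_mul_of_nonneg_right h6 (abs_nonneg (s * P * Real.sin θ - Q * Real.cos θ))
  linarith

/-- This excludes the lattice point `(0, 0)` when `y > 16δ`, since `|cos θ| + |sin θ| ≥ 1`. -/
lemma le_of_abs_mul_le {θ y δ : ℝ} (hy : 0 ≤ y)
    (hP : |3 * y * (Real.sqrt 3 * Real.cos θ)| ≤ 36 * δ)
    (hQ : |9 * y * Real.sin θ| ≤ 72 * δ) : y ≤ 16 * δ := by
  rw [abs_mul, abs_mul _ (Real.cos θ), abs_of_nonneg (a := 3 * y) (by positivity),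
    abs_of_nonneg (Real.sqrt_nonneg 3)] at hP
  rw [abs_mul, abs_of_nonneg (a := 9 * y) (by positivity)] at hQ
  have h2 : 1 ≤ |Real.cos θ| + |Real.sin θ| := by
    have := Real.sin_sq_add_cos_sq θ
    rw [← sq_abs, ← sq_abs (Real.cos θ)] at this
    nlinarith [abs_nonneg (Real.cos θ), abs_nonneg (Real.sin θ)]
  have h3 : 0 ≤ y * |Real.cos θ| := by positivity
  have h4 := mul_le_mul_of_nonneg_right five_thirds_le_sqrt_three h3
  have h5 : 3 * y * (Real.sqrt 3 * |Real.cos θ|) = 3 * (Real.sqrt 3 * (y * |Real.cos θ|)) := by ring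
  have h6 := mul_le_mul_of_nonneg_left h2 hy
  linarith

lemma mem_Icc_of_abs_sub_le {R : ℕ} {M a δ : ℝ} (z : ℤ) (hδ1 : δ ≤ 1) (hR : 2 * M + 12 ≤ R)
    (ha : |a| ≤ 9 * M) (h : |a - 2 * Real.pi * z| ≤ 72 * δ) : z ∈ Finset.Icc (-(R : ℤ)) R := by
  have hπ := Real.pi_gt_three
  have h1 : 2 * Real.pi * |(z : ℝ)| ≤ 9 * M + 72 := by
    calc 2 * Real.pi * |(z : ℝ)| = |a - (a - 2 * Real.pi * z)| := by
          rw [sub_sub_cancel, abs_mul, abs_of_pos (a := 2 * Real.pi) (by positivity)]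
      _ ≤ |a| + |a - 2 * Real.pi * z| := abs_sub _ _
      _ ≤ 9 * M + 72 := by linarith
  have h2 : 6 * |(z : ℝ)| ≤ 2 * Real.pi * |(z : ℝ)| :=
    mul_le_mul_of_nonneg_right (by linarith) (abs_nonneg _)
  have hM : 0 ≤ M := by linarith [abs_nonneg a]
  have h3 : |(z : ℝ)| ≤ R := by linarith
  rw [abs_le] at h3
  rw [Finset.mem_Icc]
  exact ⟨by exact_mod_cast h3.1, by exact_mod_cast h3.2⟩

/-- A small `φ_θ(y)` makes `1 - |φ_θ(3y)|²` at most `36δ²`. So each `1 - cos` in `sq_norm_phi_eq` is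
at most `(9/2) · 36δ² = 162δ²`, and all differences `3y(v_i - v_j)` are near `2πℤ`. Two combinations
of them are multiples of `cos θ` and `sin θ`. -/
lemma mem_badSet_of_sq_norm_phi_lt {θ y M δ : ℝ} {R : ℕ} (hθ : θ ∈ Icc 0 Real.pi) (hδ : 0 ≤ δ)
    (hδ1 : δ ≤ 1) (hR : 2 * M + 12 ≤ R) (hyM : y ≤ M) (hy : 16 * δ < y)
    (h : ‖phi θ y‖ ^ 2 < δ ^ 2) : θ ∈ badSet R (24 * δ) := by
  have h1 := (one_sub_sq_norm_phi_three_mul_le' θ y).trans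
    (mul_le_mul_of_nonneg_left h.le (by norm_num))
  rw [sq_norm_phi_eq] at h1
  have c01 := Real.cos_le_one (3 * y * (vertex θ 0 - vertex θ 1))
  have c12 := Real.cos_le_one (3 * y * (vertex θ 1 - vertex θ 2))
  have c02 := Real.cos_le_one (3 * y * (vertex θ 0 - vertex θ 2))
  obtain ⟨p, hp⟩ := exists_int_abs_sub_le hδ
    (show 1 - Real.cos (3 * y * (vertex θ 1 - vertex θ 2)) ≤ 162 * δ ^ 2 by linarith)
  obtain ⟨q₁, hq₁⟩ := exists_int_abs_sub_le hδ
    (show 1 - Real.cos (3 * y * (vertex θ 0 - vertex θ 1)) ≤ 162 * δ ^ 2 by linarith)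
  obtain ⟨q₂, hq₂⟩ := exists_int_abs_sub_le hδ
    (show 1 - Real.cos (3 * y * (vertex θ 0 - vertex θ 2)) ≤ 162 * δ ^ 2 by linarith)
  rw [vertex_one_sub_two] at hp
  have hr : |9 * y * Real.sin θ - 2 * Real.pi * ((q₁ + q₂ : ℤ) : ℝ)| ≤ 72 * δ := by
    have h2 : 9 * y * Real.sin θ - 2 * Real.pi * ((q₁ + q₂ : ℤ) : ℝ)
        = (3 * y * (vertex θ 0 - vertex θ 1) - 2 * Real.pi * q₁)
          + (3 * y * (vertex θ 0 - vertex θ 2) - 2 * Real.pi * q₂) := by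
      push_cast
      linear_combination (-3 * y) * vertex_zero_sub_add θ
    rw [h2]
    refine (abs_add_le _ _).trans ?_
    linarith
  have hy0 : 0 < y := by linarith
  refine ⟨hθ, p, mem_Icc_of_abs_sub_le p hδ1 hR ?_ (hp.trans (by linarith)), q₁ + q₂,
    mem_Icc_of_abs_sub_le _ hδ1 hR ?_ hr, ?_, abs_sqrt_three_mul_sub_le hp hr⟩
  · rw [abs_mul, abs_mul _ (Real.cos θ), abs_of_pos (a := 3 * y) (by positivity),
      abs_of_nonneg (Real.sqrt_nonneg 3)]
    have h2 : Real.sqrt 3 * |Real.cos θ| ≤ 7 / 4 * 1 :=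
      mul_le_mul sqrt_three_le (Real.abs_cos_le_one θ) (abs_nonneg _) (by norm_num)
    have h3 := mul_le_mul_of_nonneg_left h2 (show 0 ≤ 3 * y by positivity)
    linarith
  · rw [abs_mul, abs_of_pos (a := 9 * y) (by positivity)]
    have h3 := mul_le_mul_of_nonneg_left (Real.abs_sin_le_one θ) (show 0 ≤ 9 * y by positivity)
    linarith
  · by_contra hcon
    push Not at hcon
    rw [hcon.1, Int.cast_zero, mul_zero, sub_zero] at hp
    rw [hcon.2, Int.cast_zero, mul_zero, sub_zero] at hr
    exact absurd (le_of_abs_mul_le hy0.le hp hr) (not_le.2 hy)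

/-- The expression is `|z| sin(θ - ψ)` with `z = a + ib` and `ψ = arg z`, so `θ` lies within `πη /
2` of a zero `ψ + kπ`. Only `k = -1, 0, 1, 2` can occur. -/
lemma volume_abs_sin_sub_cos_le {a b η : ℝ} (hab : 1 ≤ a ^ 2 + b ^ 2) (hη : 0 ≤ η) :
    volume {θ | θ ∈ Icc 0 Real.pi ∧ |a * Real.sin θ - b * Real.cos θ| ≤ η}
      ≤ ENNReal.ofReal (16 * η) := by
  set z : ℂ := ⟨a, b⟩ with hz
  set ψ := Complex.arg z with hψ
  have ha : a = ‖z‖ * Real.cos ψ := (Complex.norm_mul_cos_arg z).symm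
  have hb : b = ‖z‖ * Real.sin ψ := (Complex.norm_mul_sin_arg z).symm
  have hz1 : 1 ≤ ‖z‖ := by
    have h1 : ‖z‖ ^ 2 = a ^ 2 + b ^ 2 := by
      rw [← Complex.normSq_eq_norm_sq, Complex.normSq_mk]; ring
    nlinarith [norm_nonneg z]
  have hπ := Real.pi_pos
  have hsub : {θ | θ ∈ Icc 0 Real.pi ∧ |a * Real.sin θ - b * Real.cos θ| ≤ η}
      ⊆ ⋃ k ∈ Finset.Icc (-1 : ℤ) 2,
        Icc (ψ + k * Real.pi - Real.pi / 2 * η) (ψ + k * Real.pi + Real.pi / 2 * η) := by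
    rintro θ ⟨⟨hθ0, hθ1⟩, hθ⟩
    set k := round ((θ - ψ) / Real.pi) with hk
    have h1 : |θ - ψ - k * Real.pi| ≤ Real.pi / 2 := by
      have h2 := abs_sub_round ((θ - ψ) / Real.pi)
      have h3 : θ - ψ - k * Real.pi = Real.pi * ((θ - ψ) / Real.pi - k) := by field_simp
      rw [h3, abs_mul, abs_of_pos hπ]
      nlinarith
    have h2 : |Real.sin (θ - ψ)| ≤ η := by
      have h3 : a * Real.sin θ - b * Real.cos θ = ‖z‖ * Real.sin (θ - ψ) := by
        rw [Real.sin_sub, ha, hb]; ring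
      rw [h3, abs_mul, abs_norm] at hθ
      nlinarith [abs_nonneg (Real.sin (θ - ψ))]
    have h3 := Real.mul_abs_le_abs_sin h1
    rw [Real.sin_sub_int_mul_pi, abs_mul, abs_zpow, abs_neg, abs_one, one_zpow, one_mul] at h3
    have h4 : |θ - ψ - k * Real.pi| ≤ Real.pi / 2 * η := by
      have h5 : |θ - ψ - k * Real.pi|
          = Real.pi / 2 * (2 / Real.pi * |θ - ψ - k * Real.pi|) := by field_simp
      rw [h5]
      exact mul_le_mul_of_nonneg_left (h3.trans h2) (by positivity)
    have hψ1 := Complex.neg_pi_lt_arg z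
    have hψ2 := Complex.arg_le_pi z
    rw [← hψ] at hψ1 hψ2
    have h6 := abs_le.1 h1
    have hk1 : -2 < k := by
      have : (-2 : ℝ) < k := by
        by_contra hcon
        nlinarith
      exact_mod_cast this
    have hk2 : k < 3 := by
      have : (k : ℝ) < 3 := by
        by_contra hcon
        nlinarith
      exact_mod_cast this
    simp only [mem_iUnion, exists_prop]
    refine ⟨k, Finset.mem_Icc.2 ⟨by omega, by omega⟩, ?_⟩
    have h7 := abs_le.1 h4
    constructor <;> linarith
  refine (measure_mono hsub).trans ((measure_biUnion_finset_le _ _).trans ?_)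
  have h : ∀ k ∈ Finset.Icc (-1 : ℤ) 2,
      volume (Icc (ψ + k * Real.pi - Real.pi / 2 * η) (ψ + k * Real.pi + Real.pi / 2 * η))
        ≤ ENNReal.ofReal (4 * η) := by
    intro k _
    rw [Real.volume_Icc]
    refine ENNReal.ofReal_le_ofReal ?_
    nlinarith [Real.pi_le_four]
  refine (Finset.sum_le_sum h).trans ?_
  rw [Finset.sum_const, show (Finset.Icc (-1 : ℤ) 2).card = 4 by decide, nsmul_eq_mul]
  rw [Nat.cast_ofNat, ← ENNReal.ofReal_ofNat 4, ← ENNReal.ofReal_mul (by norm_num)]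
  exact ENNReal.ofReal_le_ofReal (by linarith)

lemma badSet_eq (R : ℕ) (η : ℝ) :
    badSet R η = ⋃ p ∈ Finset.Icc (-(R : ℤ)) R, ⋃ r ∈ Finset.Icc (-(R : ℤ)) R,
      {θ | (p ≠ 0 ∨ r ≠ 0) ∧
        (θ ∈ Icc 0 Real.pi ∧ |Real.sqrt 3 * p * Real.sin θ - r * Real.cos θ| ≤ η)} := by
  ext θ
  simp only [badSet, mem_iUnion, mem_ofPred_eq, exists_prop]
  constructor
  · rintro ⟨hθ, p, hp, r, hr, hpr, h⟩
    exact ⟨p, hp, r, hr, hpr, hθ, h⟩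
  · rintro ⟨p, hp, r, hr, hpr, hθ, h⟩
    exact ⟨hθ, p, hp, r, hr, hpr, h⟩

lemma measurableSet_badSet (R : ℕ) (η : ℝ) : MeasurableSet (badSet R η) := by
  rw [badSet_eq]
  refine Finset.measurableSet_biUnion _ fun p _ => Finset.measurableSet_biUnion _ fun r _ => ?_
  refine (MeasurableSet.const _).inter (measurableSet_Icc.inter ?_)
  have h : Measurable fun θ => |Real.sqrt 3 * p * Real.sin θ - r * Real.cos θ| :=
    Continuous.measurable (by fun_prop)
  exact measurableSet_le h measurable_const

lemma volume_badSet_le (R : ℕ) {η : ℝ} (hη : 0 ≤ η) :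
    volume (badSet R η) ≤ ENNReal.ofReal ((2 * R + 1) ^ 2 * (16 * η)) := by
  have h : ∀ p r : ℤ, volume {θ | (p ≠ 0 ∨ r ≠ 0) ∧
      (θ ∈ Icc 0 Real.pi ∧ |Real.sqrt 3 * p * Real.sin θ - r * Real.cos θ| ≤ η)}
        ≤ ENNReal.ofReal (16 * η) := by
    intro p r
    by_cases hpr : p ≠ 0 ∨ r ≠ 0
    · simp only [hpr, true_and]
      refine volume_abs_sin_sub_cos_le ?_ hη
      rw [mul_pow, Real.sq_sqrt (by norm_num)]
      have h1 : 1 ≤ p ^ 2 + r ^ 2 := by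
        rcases hpr with hp | hr
        · have := pow_pos (abs_pos.2 hp) 2
          rw [sq_abs] at this
          nlinarith [sq_nonneg r]
        · have := pow_pos (abs_pos.2 hr) 2
          rw [sq_abs] at this
          nlinarith [sq_nonneg p]
      have h2 : (1 : ℝ) ≤ (p : ℝ) ^ 2 + (r : ℝ) ^ 2 := by exact_mod_cast h1
      nlinarith [sq_nonneg (p : ℝ)]
    · simp [hpr]
  rw [badSet_eq]
  refine (measure_biUnion_finset_le _ _).trans ?_
  refine (Finset.sum_le_sum fun p _ => (measure_biUnion_finset_le _ _).trans
    (Finset.sum_le_sum fun r _ => h p r)).trans (le_of_eq ?_)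
  have hc : ((Finset.Icc (-(R : ℤ)) R).card : ENNReal) = ENNReal.ofReal (2 * R + 1) := by
    rw [Int.card_Icc, ← ENNReal.ofReal_natCast]
    congr 1
    rw [show ((R : ℤ) + 1 - -(R : ℤ)).toNat = 2 * R + 1 by omega]
    push_cast
    ring
  rw [Finset.sum_const, Finset.sum_const, nsmul_eq_mul, nsmul_eq_mul, hc,
    ← ENNReal.ofReal_mul (by positivity), ← ENNReal.ofReal_mul (by positivity)]
  congr 1
  ring

/-! ### Splitting the product and the lower bound on `I` -/

lemma sampleIntegral_eq {ε₀ : ℝ} {N : ℕ} (n : ℕ) (θ : ℝ) (hm : 0 ≤ m ε₀ N) :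
    sampleIntegral ε₀ N n θ
      = ∫ x in (3 : ℝ) ^ ((n : ℝ) - m ε₀ N)..3 ^ n, partialProd (n + 1) θ x := by
  rw [intervalIntegral.integral_of_le, sampleIntegral, integral_Icc_eq_integral_Ioc,
    Real.rpow_natCast]
  · rfl
  · rw [← Real.rpow_natCast]
    exact Real.rpow_le_rpow_of_exponent_le (by norm_num) (by linarith)

lemma measurable_sampleIntegral {ε₀ : ℝ} {N : ℕ} (n : ℕ) (hm : 0 ≤ m ε₀ N) :
    Measurable fun θ => sampleIntegral ε₀ N n θ := by
  simp_rw [sampleIntegral_eq n _ hm]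
  exact (intervalIntegral.continuous_parametric_intervalIntegral_of_continuous'
    (continuous_partialProd (n + 1)) _ _).measurable

lemma partialProd_add (l L : ℕ) (θ x : ℝ) :
    partialProd (l + L) θ x = partialProd l θ x *
      ∏ k ∈ Finset.range L, ‖phi θ (((3 : ℝ) ^ k)⁻¹ * (((3 : ℝ) ^ l)⁻¹ * x))‖ ^ 2 := by
  rw [partialProd, Finset.prod_range_add, partialProd]
  congr 1
  refine Finset.prod_congr rfl fun k _ => ?_
  rw [pow_add]
  congr 3
  field_simp

/-- For `x ≤ 3^n` the factors of index above `n` have arguments at most `1/3, 1/9, …`, so their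
product is at least `1/2`. -/
lemma partialProd_succ_le {n N : ℕ} (hnN : n < N) (θ : ℝ) {x : ℝ} (hx0 : 0 ≤ x)
    (hx : x ≤ 3 ^ n) : partialProd (n + 1) θ x ≤ 2 * partialProd N θ x := by
  obtain ⟨L, rfl⟩ := Nat.exists_eq_add_of_lt hnN
  rw [show n + L + 1 = (n + 1) + L by ring, partialProd_add (n + 1) L]
  have h : |((3 : ℝ) ^ (n + 1))⁻¹ * x| ≤ 1 / 3 := by
    rw [abs_of_nonneg (by positivity), pow_succ, inv_mul_le_iff₀ (by positivity)]
    linarith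
  have := mul_le_mul_of_nonneg_left (prod_range_sq_norm_phi_ge_half L θ h)
    (partialProd_nonneg (n + 1) θ x)
  linarith

lemma prod_tail_ge {θ M δ y : ℝ} {R L : ℕ} (hθ : θ ∈ Icc 0 Real.pi) (hδ : 0 < δ)
    (hδ1 : δ ≤ 1) (hR : 2 * M + 12 ≤ R) (hbad : θ ∉ badSet R (24 * δ)) (hy : 16 * δ < y)
    (hM : ∀ k < L, 3 ^ k * y ≤ M) :
    ((81 : ℝ) ^ L)⁻¹ * δ ^ 2 ≤ ∏ k ∈ Finset.range L, ‖phi θ (3 ^ k * y)‖ ^ 2 := by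
  refine prod_range_sq_norm_phi_ge (by positivity) (pow_le_one₀ hδ.le hδ1) L θ y fun k hk => ?_
  by_contra hcon
  refine hbad (mem_badSet_of_sq_norm_phi_lt hθ hδ.le hδ1 hR (hM k hk) ?_ (not_le.1 hcon))
  have h1 : (1 : ℝ) ≤ 3 ^ k := one_le_pow₀ (by norm_num)
  nlinarith

lemma le_partialProd {n l R : ℕ} {θ k δ x : ℝ} (hθ : θ ∈ Icc 0 Real.pi) (hδ : 0 < δ)
    (hδ1 : δ ≤ 1) (hR : 2 * k + 12 ≤ R) (hbad : θ ∉ badSet R (24 * δ)) (hln : l ≤ n)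
    (hk : (3 : ℝ) ^ (n + 1 - l) ≤ k) (hx : 16 * δ < ((3 : ℝ) ^ n)⁻¹ * x) (hxn : x ≤ 3 ^ n) :
    (k ^ 4)⁻¹ * δ ^ 2 * partialProd l θ x ≤ partialProd (n + 1) θ x := by
  obtain ⟨L, rfl⟩ := Nat.exists_eq_add_of_le hln
  rw [show l + L + 1 - l = L + 1 by omega] at hk
  rw [show l + L + 1 = l + (L + 1) by ring, partialProd_add, mul_comm]
  refine mul_le_mul_of_nonneg_left ?_ (partialProd_nonneg l θ x)
  -- Reversed, the tail is read at the frequencies `3^j y` with `y = 3^{-n} x`, the order in which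
  -- tripling acts.
  rw [← Finset.prod_range_reflect]
  have hy1 : ((3 : ℝ) ^ (l + L))⁻¹ * x ≤ 1 := by
    rw [inv_mul_le_iff₀ (by positivity)]; linarith
  have h := prod_tail_ge (L := L + 1) (M := k) hθ hδ hδ1 hR hbad hx fun j hj => by
    have h1 : (3 : ℝ) ^ j * (((3 : ℝ) ^ (l + L))⁻¹ * x) ≤ 3 ^ j * 1 :=
      mul_le_mul_of_nonneg_left hy1 (by positivity)
    have h2 : (3 : ℝ) ^ j ≤ 3 ^ (L + 1) := pow_le_pow_right₀ (by norm_num) hj.le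
    linarith
  have h3 : (k ^ 4)⁻¹ * δ ^ 2 ≤ ((81 : ℝ) ^ (L + 1))⁻¹ * δ ^ 2 := by
    refine mul_le_mul_of_nonneg_right (inv_anti₀ (by positivity) ?_) (by positivity)
    rw [show (81 : ℝ) = 3 ^ 4 by norm_num, ← pow_mul, mul_comm, pow_mul]
    exact pow_le_pow_left₀ (by positivity) hk 4
  refine (h3.trans h).trans (le_of_eq (Finset.prod_congr rfl fun j hj => ?_))
  have hj' : j ≤ L := Nat.lt_succ_iff.1 (Finset.mem_range.1 hj)
  congr 3
  rw [show L + 1 - 1 - j = L - j by omega, pow_add, ← mul_assoc, ← mul_assoc]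
  congr 1
  have h4 : (3 : ℝ) ^ L = 3 ^ j * 3 ^ (L - j) := by rw [← pow_add]; congr 1; omega
  rw [h4]
  field_simp

lemma le_sampleIntegral {ε₀ κ θ : ℝ} {N n R : ℕ} (hκ : 38880 ≤ κ)
    (hmκ : (3 : ℝ) ^ (m ε₀ N) = κ ^ 2) (hmn : m ε₀ N ≤ n) (hnN : n ≤ N)
    (hθ : θ ∈ Icc 0 Real.pi)
    (hE : volume {x | κ ≤ fMax N θ x} ≤ ENNReal.ofReal (κ ^ (-3 : ℝ)))
    (hR : 2 * κ ^ 2 + 12 ≤ R) (hbad : θ ∉ badSet R (24 * (κ ^ 8)⁻¹)) :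
    κ ^ 2 / 81 * (κ ^ 24)⁻¹ ≤ sampleIntegral ε₀ N n θ := by
  have hκ0 : 0 < κ := by linarith
  set μ := m ε₀ N with hμ
  have h3 : (3 : ℝ) ^ (3 : ℝ) ≤ 3 ^ μ := by
    rw [hmκ]; norm_num; nlinarith
  have hμ3 : 3 ≤ μ := (Real.rpow_le_rpow_left_iff (by norm_num)).1 h3
  rw [sampleIntegral_eq n θ (by linarith), ← hμ]
  set X : ℝ := 3 ^ ((n : ℝ) - μ) with hX
  have hXeq : X * κ ^ 2 = 3 ^ n := by
    rw [hX, ← hmκ, ← Real.rpow_add (by norm_num), sub_add_cancel, Real.rpow_natCast]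
  have hX0 : 0 < X := by positivity
  have hXn : X ≤ 3 ^ n := by nlinarith
  -- The offset `2` puts `3^l` between `9X` and `27X`: large enough that `X ≤ 3^l / 6`, small enough
  -- for the diagonal lower bound `κ² / 54`. That `l ≤ n` uses `μ ≥ 3`.
  set l := ⌈(n : ℝ) - μ⌉₊ + 2 with hl
  have hl1 : (n : ℝ) - μ + 2 ≤ l := by
    rw [hl]; push_cast; linarith [Nat.le_ceil ((n : ℝ) - μ)]
  have hl2 : (l : ℝ) < n - μ + 3 := by
    rw [hl]; push_cast
    linarith [Nat.ceil_lt_add_one (show (0 : ℝ) ≤ (n : ℝ) - μ by linarith)]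
  have hln : l ≤ n := by
    have : (l : ℝ) ≤ n := by linarith
    exact_mod_cast this
  have hXl : X * 9 ≤ 3 ^ l := by
    have : X * 9 = 3 ^ ((n : ℝ) - μ + 2) := by
      rw [Real.rpow_add (by norm_num), ← hX]; norm_num
    rw [this, ← Real.rpow_natCast]
    exact Real.rpow_le_rpow_of_exponent_le (by norm_num) hl1
  have hlX : (3 : ℝ) ^ l ≤ X * 27 := by
    have : X * 27 = 3 ^ ((n : ℝ) - μ + 3) := by
      rw [Real.rpow_add (by norm_num), ← hX]; norm_num
    rw [this, ← Real.rpow_natCast]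
    exact Real.rpow_le_rpow_of_exponent_le (by norm_num) hl2.le
  have hk : (3 : ℝ) ^ (n + 1 - l) ≤ κ ^ 2 := by
    rw [pow_sub₀ _ (by norm_num) (by omega), ← div_eq_mul_inv, div_le_iff₀ (by positivity),
      pow_succ, ← hXeq]
    nlinarith [pow_pos hκ0 2]
  have hc := continuous_partialProd_right l θ
  have hc' := continuous_partialProd_right (n + 1) θ
  have hlow := le_integral_partialProd l θ (T := 3 ^ n) (by positivity)
  have hup := integral_partialProd_le hκ0.le
    (lintegral_cnt_sq_le (by linarith) hE l (hln.trans hnN)) hX0.le (by linarith)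
  rw [← intervalIntegral.integral_add_adjacent_intervals (hc.intervalIntegrable 0 X)
    (hc.intervalIntegrable X (3 ^ n))] at hlow
  have hlow2 : κ ^ 2 / 54 ≤ ((3 : ℝ) ^ l)⁻¹ * 3 ^ n / 2 := by
    rw [← hXeq, div_le_div_iff₀ (by norm_num) (by norm_num), inv_mul_eq_div, div_mul_eq_mul_div,
      le_div_iff₀ (by positivity)]
    nlinarith [pow_pos hκ0 2]
  -- `κ²/54 - κ²/81 = κ²/162` absorbs `240κ` because `38880 = 162 · 240`.
  have hmid : κ ^ 2 / 81 ≤ ∫ x in X..3 ^ n, partialProd l θ x := by nlinarith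
  have h1 : ∫ x in X..3 ^ n, (κ ^ 24)⁻¹ * partialProd l θ x
      ≤ ∫ x in X..3 ^ n, partialProd (n + 1) θ x := by
    refine intervalIntegral.integral_mono_on hXn (Continuous.intervalIntegrable (by fun_prop) _ _)
      (hc'.intervalIntegrable _ _) fun x hx => ?_
    have hx2 : 16 * (κ ^ 8)⁻¹ < ((3 : ℝ) ^ n)⁻¹ * x := by
      have h2 : ((3 : ℝ) ^ n)⁻¹ * X = (κ ^ 2)⁻¹ := by
        rw [← hXeq]; field_simp
      have h4 := mul_le_mul_of_nonneg_left hx.1 (a := ((3 : ℝ) ^ n)⁻¹) (by positivity)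
      rw [h2] at h4
      refine lt_of_lt_of_le ?_ h4
      rw [← div_eq_mul_inv, div_lt_iff₀ (by positivity), show κ ^ 8 = κ ^ 2 * κ ^ 6 by ring,
        inv_mul_cancel_left₀ (by positivity)]
      calc (16 : ℝ) < 38880 ^ 6 := by norm_num
        _ ≤ κ ^ 6 := pow_le_pow_left₀ (by norm_num) hκ 6
    have h5 := le_partialProd (δ := (κ ^ 8)⁻¹) hθ (by positivity)
      (inv_le_one_of_one_le₀ (one_le_pow₀ (by linarith))) hR hbad hln hk hx2 hx.2
    refine le_trans (le_of_eq ?_) h5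
    congr 1
    rw [inv_pow, ← mul_inv]
    congr 1
    ring
  rw [intervalIntegral.integral_const_mul] at h1
  refine le_trans ?_ h1
  rw [mul_comm]
  exact mul_le_mul_of_nonneg_left hmid (by positivity)

/-! ### The upper bound by averaging over `n` -/

lemma card_le_of_mem_Icc {S : Finset ℕ} {t μ : ℝ} (hμ : 0 ≤ μ)
    (h : ∀ n ∈ S, t ≤ n ∧ (n : ℝ) ≤ t + μ) : (S.card : ℝ) ≤ μ + 1 := by
  have h1 : S.card ≤ (Finset.Icc ⌈t⌉ ⌊t + μ⌋).card := by
    refine Finset.card_le_card_of_injOn (fun n => (n : ℤ)) (fun n hn => ?_)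
      Nat.cast_injective.injOn
    obtain ⟨h2, h3⟩ := h n hn
    simp only [Finset.coe_Icc, mem_Icc]
    exact ⟨Int.ceil_le.2 (by exact_mod_cast h2), Int.le_floor.2 (by exact_mod_cast h3)⟩
  rw [Int.card_Icc] at h1
  have h2 : ((⌊t + μ⌋ + 1 - ⌈t⌉).toNat : ℝ) ≤ μ + 1 := by
    rcases le_total 0 (⌊t + μ⌋ + 1 - ⌈t⌉) with h3 | h3
    · have h4 : ((⌊t + μ⌋ + 1 - ⌈t⌉).toNat : ℝ) = ((⌊t + μ⌋ + 1 - ⌈t⌉ : ℤ) : ℝ) := by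
        exact_mod_cast Int.toNat_of_nonneg h3
      rw [h4]
      push_cast
      linarith [Int.floor_le (t + μ), Int.le_ceil t]
    · rw [Int.toNat_of_nonpos h3]
      push_cast
      linarith
  exact le_trans (by exact_mod_cast h1) h2

/-- A point `x` lies in the interval of index `n` only if `log₃ x ≤ n ≤ log₃ x + m`, so the overlap
is at most `m + 1`. All products are compared with the single `P_N`, whose integral is `O(κ)`. -/
lemma sum_sampleIntegral_le {ε₀ κ θ : ℝ} {N : ℕ} (hκ : 216 ≤ κ) (hm : 0 ≤ m ε₀ N)
    (hE : volume {x | κ ≤ fMax N θ x} ≤ ENNReal.ofReal (κ ^ (-3 : ℝ)))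
    {S : Finset ℕ} (hS : ∀ n ∈ S, n + 2 ≤ N) :
    ∑ n ∈ S, sampleIntegral ε₀ N n θ ≤ 480 * κ * (m ε₀ N + 1) := by
  set μ := m ε₀ N with hμ
  set T : ℝ := 3 ^ N / 6 with hT
  let I : ℕ → Set ℝ := fun n => Icc ((3 : ℝ) ^ ((n : ℝ) - μ)) ((3 : ℝ) ^ (n : ℝ))
  have hc := continuous_partialProd_right N θ
  have hIT : ∀ n ∈ S, I n ⊆ Icc 0 T := by
    intro n hn x hx
    refine ⟨le_trans (by positivity) hx.1, hx.2.trans ?_⟩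
    rw [Real.rpow_natCast, hT, le_div_iff₀ (by norm_num)]
    have : (3 : ℝ) ^ (n + 2) ≤ 3 ^ N := pow_le_pow_right₀ (by norm_num) (hS n hn)
    rw [pow_add] at this
    have h0 : (0 : ℝ) < 3 ^ n := by positivity
    linarith
  have hint : IntegrableOn (fun x => partialProd N θ x) (Icc 0 T) := hc.integrableOn_Icc
  have h1 : ∀ n ∈ S, sampleIntegral ε₀ N n θ
      ≤ ∫ x in Icc 0 T, 2 * (I n).indicator (fun x => partialProd N θ x) x := by
    intro n hn
    rw [integral_const_mul, setIntegral_indicator measurableSet_Icc,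
      inter_eq_self_of_subset_right (hIT n hn), ← integral_const_mul]
    refine setIntegral_mono_on ?_ ?_ measurableSet_Icc fun x hx => ?_
    · exact (continuous_partialProd_right (n + 1) θ).integrableOn_Icc
    · exact (hc.const_mul 2).integrableOn_Icc
    · refine partialProd_succ_le (by have := hS n hn; omega) θ (hIT n hn hx).1 ?_
      have := hx.2
      rwa [Real.rpow_natCast] at this
  have hind : ∀ n ∈ S, IntegrableOn
      (fun x => 2 * (I n).indicator (fun x => partialProd N θ x) x) (Icc 0 T) :=
    fun n _ => (hint.indicator measurableSet_Icc).const_mul 2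
  calc ∑ n ∈ S, sampleIntegral ε₀ N n θ
      ≤ ∑ n ∈ S, ∫ x in Icc 0 T, 2 * (I n).indicator (fun x => partialProd N θ x) x :=
        Finset.sum_le_sum h1
    _ = ∫ x in Icc 0 T, ∑ n ∈ S, 2 * (I n).indicator (fun x => partialProd N θ x) x :=
        (integral_finsetSum _ hind).symm
    _ ≤ ∫ x in Icc 0 T, 2 * (μ + 1) * partialProd N θ x := by
        refine setIntegral_mono_on (integrable_finsetSum _ hind) (hint.const_mul _)
          measurableSet_Icc fun x hx => ?_
        have hpp := partialProd_nonneg N θ x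
        rw [← Finset.mul_sum, mul_assoc]
        refine mul_le_mul_of_nonneg_left ?_ (by norm_num)
        classical
        have h2 : ∑ n ∈ S, (I n).indicator (fun x => partialProd N θ x) x
            = ((S.filter fun n => x ∈ I n).card : ℝ) * partialProd N θ x := by
          simp only [indicator_apply]
          rw [← Finset.sum_filter, Finset.sum_const, nsmul_eq_mul]
        rw [h2]
        refine mul_le_mul_of_nonneg_right ?_ hpp
        refine card_le_of_mem_Icc (t := Real.logb 3 x) hm fun n hn => ?_
        obtain ⟨h3, h4⟩ := (Finset.mem_filter.1 hn).2
        have hx0 : 0 < x := lt_of_lt_of_le (by positivity) h3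
        constructor
        · rwa [Real.logb_le_iff_le_rpow (by norm_num) hx0]
        · have := (Real.le_logb_iff_rpow_le (by norm_num) hx0).2 h3
          linarith
    _ = 2 * (μ + 1) * ∫ x in (0 : ℝ)..T, partialProd N θ x := by
        rw [integral_const_mul, intervalIntegral.integral_of_le (by positivity),
          integral_Icc_eq_integral_Ioc]
    _ ≤ 2 * (μ + 1) * (240 * κ) := by
        refine mul_le_mul_of_nonneg_left ?_ (by positivity)
        exact integral_partialProd_le (by linarith) (lintegral_cnt_sq_le hκ hE N le_rfl)
          (by positivity) le_rfl
    _ = _ := by ring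

lemma volume_E_ne_top (ε₀ : ℝ) (N : ℕ) : volume (E ε₀ N) ≠ ⊤ :=
  measure_ne_top_of_subset (fun _ h => h.1) (by simp : volume (Icc 0 Real.pi) ≠ ⊤)

/-- Chebyshev in `n` for fixed `θ`, then Fubini. As `61440 = 64 · 960` and `480(m + 1) ≤ 960m`, each
`θ` fails for at most `N/64` of the at least `N/8` indices, so some index fails on at most an eighth
of `E`. -/
lemma exists_measureReal_le {ε₀ : ℝ} {N : ℕ} (hK : 216 ≤ K ε₀ N) (hm : 1 ≤ m ε₀ N)
    (hN : 16 ≤ N) :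
    ∃ n : ℕ, (N : ℝ) / 4 < n ∧ (n : ℝ) < N / 2 ∧
      volume.real {θ | θ ∈ E ε₀ N ∧ 61440 * K ε₀ N * m ε₀ N / N < sampleIntegral ε₀ N n θ}
        ≤ volume.real (E ε₀ N) / 8 := by
  set V := volume.real (E ε₀ N) with hV
  set S := Finset.Icc (N / 4 + 1) ((N - 1) / 2) with hS
  set c := 61440 * K ε₀ N * m ε₀ N / N with hc
  let G : ℕ → Set ℝ := fun n => {θ | θ ∈ E ε₀ N ∧ c < sampleIntegral ε₀ N n θ}
  have hN0 : (0 : ℝ) < N := by exact_mod_cast (by omega : 0 < N)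
  have hc0 : 0 < c := by positivity
  have hmE := measurableSet_E ε₀ N
  have hG : ∀ n, MeasurableSet (G n) := fun n =>
    hmE.inter (measurableSet_lt measurable_const (measurable_sampleIntegral n (by linarith)))
  have hcard : (N : ℝ) / 8 ≤ S.card := by
    rw [hS, Nat.card_Icc]
    have : N ≤ 8 * ((N - 1) / 2 + 1 - (N / 4 + 1)) := by omega
    have h2 : (N : ℝ) ≤ 8 * (((N - 1) / 2 + 1 - (N / 4 + 1) : ℕ) : ℝ) := by exact_mod_cast this
    linarith
  have hne : S.Nonempty := by
    rw [← Finset.card_pos]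
    have : (0 : ℝ) < S.card := by linarith
    exact_mod_cast this
  by_contra! hcon
  have hlarge : ∀ n ∈ S, V / 8 < volume.real (G n) := by
    intro n hn
    obtain ⟨h1, h2⟩ := Finset.mem_Icc.1 hn
    refine hcon n ?_ ?_
    · have : N < 4 * n := by omega
      have : (N : ℝ) < 4 * n := by exact_mod_cast this
      linarith
    · have : 2 * n < N := by omega
      have : 2 * (n : ℝ) < N := by exact_mod_cast this
      linarith
  have hpt : ∀ θ ∈ E ε₀ N, ∑ n ∈ S, (G n).indicator (fun _ => (1 : ℝ)) θ ≤ N / 64 := by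
    intro θ hθ
    have h1 : ∑ n ∈ S, c * (G n).indicator (fun _ => (1 : ℝ)) θ
        ≤ ∑ n ∈ S, sampleIntegral ε₀ N n θ := by
      refine Finset.sum_le_sum fun n _ => ?_
      classical
      rw [indicator_apply]
      split_ifs with h
      · rw [mul_one]; exact h.2.le
      · rw [mul_zero]
        exact setIntegral_nonneg measurableSet_Icc fun x _ => partialProd_nonneg (n + 1) θ x
    have h2 := h1.trans (sum_sampleIntegral_le hK (by linarith) hθ.2 fun n hn => by
      obtain ⟨h1, h2⟩ := Finset.mem_Icc.1 hn
      omega)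
    rw [← Finset.mul_sum] at h2
    have h3 : 480 * K ε₀ N * (m ε₀ N + 1) ≤ c * (N / 64) := by
      have : c * (N / 64) = 960 * K ε₀ N * m ε₀ N := by
        rw [hc]; field_simp; norm_num
      rw [this]
      nlinarith
    exact le_of_mul_le_mul_left (h2.trans h3) hc0
  have hfin : IsFiniteMeasure (volume.restrict (E ε₀ N)) :=
    ⟨by rw [Measure.restrict_apply_univ]; exact (volume_E_ne_top ε₀ N).lt_top⟩
  have hint : ∀ n ∈ S, Integrable (fun θ => (G n).indicator (fun _ => (1 : ℝ)) θ)
      (volume.restrict (E ε₀ N)) := fun n _ => (integrable_const _).indicator (hG n)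
  have hsum : ∑ n ∈ S, volume.real (G n) ≤ V * (N / 64) := by
    calc ∑ n ∈ S, volume.real (G n)
        = ∑ n ∈ S, ∫ θ in E ε₀ N, (G n).indicator (fun _ => (1 : ℝ)) θ := by
          refine Finset.sum_congr rfl fun n _ => ?_
          rw [setIntegral_indicator (hG n), inter_eq_self_of_subset_right fun θ h => h.1,
            setIntegral_const, smul_eq_mul, mul_one]
      _ = ∫ θ in E ε₀ N, ∑ n ∈ S, (G n).indicator (fun _ => (1 : ℝ)) θ :=
          (integral_finsetSum _ hint).symm
      _ ≤ ∫ θ in E ε₀ N, (N : ℝ) / 64 :=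
          setIntegral_mono_on (integrable_finsetSum _ hint) (integrable_const _) hmE hpt
      _ = V * (N / 64) := by rw [setIntegral_const, smul_eq_mul]
  have hlt := Finset.sum_lt_sum_of_nonempty hne hlarge
  rw [Finset.sum_const, nsmul_eq_mul] at hlt
  have hV0 : 0 ≤ V := measureReal_nonneg
  nlinarith

/-! ### Parameters and conclusion -/

lemma three_rpow_m {ε₀ : ℝ} {N : ℕ} (hN : 0 < N) : (3 : ℝ) ^ (m ε₀ N) = K ε₀ N ^ 2 := by
  have hN0 : (0 : ℝ) < N := by exact_mod_cast hN
  rw [m, mul_comm, Real.rpow_mul (by norm_num), Real.rpow_logb (by norm_num) (by norm_num) hN0, K,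
    ← Real.rpow_natCast, ← Real.rpow_mul hN0.le]
  congr 1
  push_cast
  ring

lemma three_rpow_m_sub {ε₀ : ℝ} (A : ℝ) {N : ℕ} (hN : 0 < N) :
    (3 : ℝ) ^ (m ε₀ N - 2 * (A * m ε₀ N)) = (N : ℝ) ^ (-2 * ε₀ * (2 * A - 1)) := by
  have hN0 : (0 : ℝ) < N := by exact_mod_cast hN
  rw [m, show 2 * ε₀ * Real.logb 3 N - 2 * (A * (2 * ε₀ * Real.logb 3 N))
    = Real.logb 3 N * (-2 * ε₀ * (2 * A - 1)) by ring, Real.rpow_mul (by norm_num),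
    Real.rpow_logb (by norm_num) (by norm_num) hN0]

lemma eventually_le_K {ε₀ : ℝ} (hε : 0 < ε₀) (c : ℝ) :
    ∀ᶠ N : ℕ in Filter.atTop, c ≤ K ε₀ N :=
  ((tendsto_rpow_atTop hε).comp tendsto_natCast_atTop_atTop).eventually_ge_atTop c

lemma eventually_m_le {ε₀ : ℝ} (hε : 0 < ε₀) :
    ∀ᶠ N : ℕ in Filter.atTop, m ε₀ N ≤ N / 4 := by
  have hlog3 : 0 < Real.log 3 := Real.log_pos (by norm_num)
  have h := tendsto_natCast_atTop_atTop (R := ℝ) |>.eventually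
    (Real.isLittleO_log_id_atTop.bound (show 0 < Real.log 3 / (8 * ε₀) by positivity))
  filter_upwards [h] with N hN
  simp only [id, Real.norm_eq_abs, Nat.abs_cast] at hN
  have h2 := (le_abs_self _).trans hN
  rw [m, Real.logb]
  calc 2 * ε₀ * (Real.log N / Real.log 3)
      ≤ 2 * ε₀ * (Real.log 3 / (8 * ε₀) * N / Real.log 3) := by gcongr
    _ = N / 4 := by field_simp; ring

/-- Outside a small exceptional set of directions, the integral is bounded below. -/
lemma exists_exceptional_set {ε₀ : ℝ} {N : ℕ} (hK : 38880 ≤ K ε₀ N) (hN : 0 < N)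
    (hm : m ε₀ N ≤ N / 4) {A : ℝ} (hA : 6 ≤ A) :
    ∃ B : Set ℝ, MeasurableSet B ∧ volume B ≤ ENNReal.ofReal ((N : ℝ) ^ (-ε₀) / 8) ∧
      ∀ n : ℕ, (N : ℝ) / 4 < n → n ≤ N → ∀ θ ∈ E ε₀ N, θ ∉ B →
        1 / 81 * (3 : ℝ) ^ (m ε₀ N - 2 * (A * m ε₀ N)) ≤ sampleIntegral ε₀ N n θ := by
  set κ := K ε₀ N with hκ
  have hκ0 : 0 < κ := by linarith
  have hN0 : (0 : ℝ) < N := by exact_mod_cast hN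
  have hmκ : (3 : ℝ) ^ (m ε₀ N) = κ ^ 2 := three_rpow_m hN
  set R := ⌈2 * κ ^ 2 + 12⌉₊ with hR
  have hR1 : 2 * κ ^ 2 + 12 ≤ R := Nat.le_ceil _
  have hR2 : (R : ℝ) ≤ 2 * κ ^ 2 + 13 := by
    linarith [Nat.ceil_lt_add_one (show 0 ≤ 2 * κ ^ 2 + 12 by positivity)]
  -- There are `O(κ⁴)` lattice vectors, each excluding measure `O(κ^{-8})`; the total `O(κ^{-4})` is
  -- well below `κ⁻¹ / 8 = N^{-ε₀} / 8`.
  refine ⟨badSet R (24 * (κ ^ 8)⁻¹), measurableSet_badSet _ _,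
    (volume_badSet_le R (by positivity)).trans (ENNReal.ofReal_le_ofReal ?_),
    fun n hn hnN θ hθ hbad => ?_⟩
  · have h1 : (N : ℝ) ^ (-ε₀) = κ⁻¹ := by rw [Real.rpow_neg hN0.le]; rfl
    have h2 : 2 * (R : ℝ) + 1 ≤ 5 * κ ^ 2 := by nlinarith
    have h3 : (2 * (R : ℝ) + 1) ^ 2 ≤ (5 * κ ^ 2) ^ 2 := pow_le_pow_left₀ (by positivity) h2 2
    rw [h1]
    calc (2 * (R : ℝ) + 1) ^ 2 * (16 * (24 * (κ ^ 8)⁻¹))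
        ≤ (5 * κ ^ 2) ^ 2 * (16 * (24 * (κ ^ 8)⁻¹)) := by gcongr
      _ = 9600 / κ ^ 3 * κ⁻¹ := by field_simp; norm_num
      _ ≤ 1 / 8 * κ⁻¹ := by
          refine mul_le_mul_of_nonneg_right ?_ (by positivity)
          rw [div_le_iff₀ (by positivity)]
          have : (38880 : ℝ) ^ 3 ≤ κ ^ 3 := pow_le_pow_left₀ (by norm_num) hK 3
          linarith
      _ = κ⁻¹ / 8 := by ring
  · have hm0 : 0 ≤ m ε₀ N := by
      have : (3 : ℝ) ^ (0 : ℝ) ≤ 3 ^ (m ε₀ N) := by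
        rw [hmκ, Real.rpow_zero]; nlinarith
      exact (Real.rpow_le_rpow_left_iff (by norm_num)).1 this
    refine le_trans ?_ (le_sampleIntegral hK hmκ (by linarith) hnN hθ.1 hθ.2 hR1 hbad)
    -- Since `3^m = κ²`, the loss `κ^{-24}` is `3^{-12m}`, which `A ≥ 6` covers.
    have h1 : (3 : ℝ) ^ (m ε₀ N - 2 * (A * m ε₀ N)) ≤ 3 ^ (m ε₀ N - 12 * m ε₀ N) :=
      Real.rpow_le_rpow_of_exponent_le (by norm_num) (by nlinarith)
    have h2 : (3 : ℝ) ^ (m ε₀ N - 12 * m ε₀ N) = κ ^ 2 * (κ ^ 24)⁻¹ := by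
      rw [Real.rpow_sub (by norm_num), mul_comm 12, Real.rpow_mul (by norm_num), hmκ,
        show (12 : ℝ) = ((12 : ℕ) : ℝ) by norm_num, Real.rpow_natCast, ← pow_mul]
      rfl
    rw [h2] at h1
    linarith

end Gasket

theorem mainTheorem4 :
    ∃ A₀ c C : ℝ, 1 ≤ A₀ ∧ 0 < c ∧ 0 < C ∧
      ∀ A : ℝ, A₀ ≤ A → ∀ ε₀ : ℝ, 0 < ε₀ → ∃ N₀ : ℕ, ∀ N : ℕ, N₀ ≤ N →
        -- the two forms of the lower bound agree
        c * (3 : ℝ) ^ (Gasket.m ε₀ N - 2 * (A * Gasket.m ε₀ N))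
            = c * (N : ℝ) ^ (-2 * ε₀ * (2 * A - 1)) ∧
        ((N : ℝ) ^ (-ε₀) ≤ volume.real (Gasket.E ε₀ N) →
          -- the number `n` and the set `Et` exist, with the lower bound on all of `Et`
          (∃ n : ℕ, (N : ℝ) / 4 < n ∧ (n : ℝ) < N / 2 ∧
            ∃ Et : Set ℝ, MeasurableSet Et ∧ Et ⊆ Gasket.E ε₀ N ∧
              volume.real (Gasket.E ε₀ N) / 2 < volume.real Et ∧
              ∀ θ ∈ Et,
                Gasket.sampleIntegral ε₀ N n θ ≤ C * Gasket.K ε₀ N * Gasket.m ε₀ N / N ∧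
                c * (3 : ℝ) ^ (Gasket.m ε₀ N - 2 * (A * Gasket.m ε₀ N))
                  ≤ Gasket.sampleIntegral ε₀ N n θ) ∧
          -- for every other choice of `n` and `Et`, it holds on more than half of `Et`
          (∀ n : ℕ, (N : ℝ) / 4 < n → (n : ℝ) < N / 2 →
            ∀ Et : Set ℝ, MeasurableSet Et → Et ⊆ Gasket.E ε₀ N →
              volume.real (Gasket.E ε₀ N) / 2 < volume.real Et →
              ∃ Eg : Set ℝ, MeasurableSet Eg ∧ Eg ⊆ Et ∧
                volume.real Et / 2 < volume.real Eg ∧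
                ∀ θ ∈ Eg,
                  c * (3 : ℝ) ^ (Gasket.m ε₀ N - 2 * (A * Gasket.m ε₀ N))
                    ≤ Gasket.sampleIntegral ε₀ N n θ)) := by
  refine ⟨6, 1 / 81, 61440, by norm_num, by norm_num, by norm_num, fun A hA ε₀ hε => ?_⟩
  obtain ⟨N₀, hN₀⟩ := Filter.eventually_atTop.1
    ((Gasket.eventually_le_K hε 38880).and
      ((Gasket.eventually_m_le hε).and (Filter.eventually_ge_atTop 16)))
  refine ⟨N₀, fun N hN => ?_⟩
  obtain ⟨hK, hm, hN16⟩ := hN₀ N hN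
  have hN0 : 0 < N := by omega
  refine ⟨by rw [Gasket.three_rpow_m_sub A hN0], fun hE => ?_⟩
  obtain ⟨B, hBm, hBv, hB⟩ := Gasket.exists_exceptional_set hK hN0 hm hA
  have hpos : (0 : ℝ) < (N : ℝ) ^ (-ε₀) := Real.rpow_pos_of_pos (by exact_mod_cast hN0) _
  have hBr : volume.real B ≤ volume.real (Gasket.E ε₀ N) / 8 := by
    have := ENNReal.toReal_mono ENNReal.ofReal_ne_top hBv
    rw [ENNReal.toReal_ofReal (by positivity)] at this
    rw [measureReal_def]
    linarith
  have hdiff : ∀ S : Set ℝ, S ⊆ Gasket.E ε₀ N → ∀ T : Set ℝ, volume T ≠ ⊤ →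
      volume.real S - volume.real T ≤ volume.real (S \ T) := by
    intro S hS T hT
    have h1 : volume.real S ≤ volume.real (S \ T ∪ T) := by
      refine measureReal_mono (by rw [sdiff_union_self]; exact subset_union_left) ?_
      exact measure_union_ne_top (measure_ne_top_of_subset (sdiff_subset.trans hS)
        (Gasket.volume_E_ne_top ε₀ N)) hT
    linarith [measureReal_union_le (μ := volume) (S \ T) T]
  have hBtop : volume B ≠ ⊤ := ne_top_of_le_ne_top ENNReal.ofReal_ne_top hBv
  constructor
  · have hm1 : 1 ≤ Gasket.m ε₀ N := by
      have : (3 : ℝ) ^ (1 : ℝ) ≤ 3 ^ (Gasket.m ε₀ N) := by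
        rw [Gasket.three_rpow_m hN0, Real.rpow_one]; nlinarith
      exact (Real.rpow_le_rpow_left_iff (by norm_num)).1 this
    obtain ⟨n, hn1, hn2, hG⟩ := Gasket.exists_measureReal_le (by linarith) hm1 hN16
    set G := {θ | θ ∈ Gasket.E ε₀ N ∧
      61440 * Gasket.K ε₀ N * Gasket.m ε₀ N / N < Gasket.sampleIntegral ε₀ N n θ} with hGdef
    have hGm : MeasurableSet G := (Gasket.measurableSet_E ε₀ N).inter
      (measurableSet_lt measurable_const (Gasket.measurable_sampleIntegral n (by linarith)))
    have hGtop : volume G ≠ ⊤ :=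
      measure_ne_top_of_subset (fun _ h => h.1) (Gasket.volume_E_ne_top ε₀ N)
    -- Each of the two removed sets takes at most `|E| / 8`, so at least three quarters of `E`
    -- remain; strictness uses `|E| > 0`.
    refine ⟨n, hn1, hn2, (Gasket.E ε₀ N \ G) \ B,
      ((Gasket.measurableSet_E ε₀ N).diff hGm).diff hBm, sdiff_subset.trans sdiff_subset, ?_, ?_⟩
    · have h1 := hdiff (Gasket.E ε₀ N) Subset.rfl G hGtop
      have h2 := hdiff (Gasket.E ε₀ N \ G) sdiff_subset B hBtop
      linarith
    · rintro θ ⟨⟨hθ, hθG⟩, hθB⟩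
      refine ⟨?_, hB n hn1 ?_ θ hθ hθB⟩
      · by_contra hcon
        exact hθG ⟨hθ, not_le.1 hcon⟩
      · have : (n : ℝ) ≤ N := by linarith [show (0 : ℝ) ≤ N from Nat.cast_nonneg N]
        exact_mod_cast this
  · intro n hn1 hn2 Et hEt hsub hvol
    -- The set `B` does not depend on `n`, and `|B| ≤ |E| / 8 < |Et| / 4`.
    refine ⟨Et \ B, hEt.diff hBm, sdiff_subset, ?_, ?_⟩
    · have h1 := hdiff Et hsub B hBtop
      linarith
    · rintro θ ⟨hθ, hθB⟩
      refine hB n hn1 ?_ θ (hsub hθ) hθB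
      have : (n : ℝ) ≤ N := by linarith [show (0 : ℝ) ≤ N from Nat.cast_nonneg N]
      exact_mod_cast this
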